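/- Let $g:\mathbb R\to\mathbb C$ and $\omega:\mathbb R\to\mathbb R$ be such that the integral $G(t)=\int_{\mathbb R}|g(k)|^2e^{-i\omega(k)t}\,dk$ converges for all $t\ge 0$ and defines a continuous function (the bath correlation function). Let $\tilde G(p)=\int_0^{+\infty}e^{-pt}G(t)\,dt$ be its Laplace transform ($\operatorname{Re}p>0$), and assume that $\tilde G$ extends to the closed half-plane $\operatorname{Re}p\ge 0$ as a twice continuously (complex) differentiable function with bounded second derivative; the extension and its derivatives (one-sided on $\operatorname{Re}p=0$) are still denoted by $\tilde G,\tilde G'$. Let $H_S^{(0)},H_S^{(2)}$ be Hermitian $N\times N$ matrices and, for real $\lambda\ne 0$, let $V_\lambda(t)$, $t\ge0$, be the solution of $$\frac{d}{dt}V_\lambda(t)=-\lambda^2\int_0^t G(t-s)\,e^{i(H_S^{(0)}+\lambda^2H_S^{(2)})(t-s)}\,V_\lambda(s)\,ds,\qquad V_\lambda(0)=1,$$ and put $W_\lambda(t)=V_\lambda(\lambda^{-2}t)$. For a Hermitian matrix $A=\sum_a a\,\Pi_a$ (spectral decomposition) write $F(-iA)=\sum_a F(-ia)\,\Pi_a$;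 let $\frac{\delta \tilde G}{\delta p}(x,y)=\frac{\tilde G(x)-\tilde G(y)}{x-y}$ for $x\ne y$ and $\frac{\delta \tilde G}{\delta p}(x,x)=\tilde G'(x)$; and, with $H_S^{(0)}=\sum_E E\,\Pi_E$, let $$\overset{2}{H_S^{(2)}}\frac{\delta\tilde G}{\delta p}(-i\overset{1}{H_S^{(0)}},-i\overset{3}{H_S^{(0)}})=\sum_{E,E'}\frac{\delta\tilde G}{\delta p}(-iE,-iE')\,\Pi_{E'}H_S^{(2)}\Pi_{E}$$ (Feynman ordering). Then for every fixed $t>0$, as $\lambda\to0$, $$W_\lambda(t)=e^{Lt}\,r+O(\lambda^4),$$ where $r=1-\lambda^2\tilde G'(-iH_S^{(0)})$ and $$L=-\tilde G(-iH_S^{(0)})+\lambda^2\Big(\tilde G'(-iH_S^{(0)})\,\tilde G(-iH_S^{(0)})+i\,\overset{2}{H_S^{(2)}}\frac{\delta\tilde G}{\delta p}(-i\overset{1}{H_S^{(0)}},-i\overset{3}{H_S^{(0)}})\Big).$$ -/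

import Mathlib

open Filter Topology MeasureTheory Set Asymptotics

namespace RWAModel

noncomputable section

/-- Square complex matrices of size `N`. -/
abbrev Mat (N : ℕ) : Type := Matrix (Fin N) (Fin N) ℂ

/-- The bath correlation function `G(t) = ∫ |g(k)|² e^{-i ω(k) t} dk` of a reservoir with
form factor `g` and dispersion relation `ω`. -/
def bathCorrelation (g : ℝ → ℂ) (ω : ℝ → ℝ) (t : ℝ) : ℂ :=
  ∫ k : ℝ, ((‖g k‖ ^ 2 : ℝ) : ℂ) * Complex.exp (-Complex.I * (ω k : ℂ) * (t : ℂ))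

/-- The integral defining the bath correlation function converges for every `t ≥ 0`, and it
defines a continuous function of `t ≥ 0`. -/
def BathAdmissible (g : ℝ → ℂ) (ω : ℝ → ℝ) : Prop :=
  (∀ t : ℝ, 0 ≤ t → Integrable fun k : ℝ =>
    ((‖g k‖ ^ 2 : ℝ) : ℂ) * Complex.exp (-Complex.I * (ω k : ℂ) * (t : ℂ))) ∧
  ContinuousOn (bathCorrelation g ω) (Ici 0)

/-- `V` solves `V'(t) = -∫₀ᵗ K(t-s) e^{i H (t-s)} V(s) ds` for `t ≥ 0` with `V(0) = 1`
(one-sided derivative at `t = 0`; derivative and integral of matrices are taken entrywise). -/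
def IsPropagator {N : ℕ} (K : ℝ → ℂ) (H : Mat N) (V : ℝ → Mat N) : Prop :=
  V 0 = 1 ∧
  ∀ t : ℝ, 0 ≤ t → ∀ i j : Fin N,
    HasDerivWithinAt (fun u : ℝ => V u i j)
      (-∫ s in (0 : ℝ)..t,
        (K (t - s) • (NormedSpace.exp ((Complex.I * ((t - s : ℝ) : ℂ)) • H) * V s)) i j)
      (Ici 0) t

/-- The closed right half-plane `Re p ≥ 0`. -/
def closedHalfPlane : Set ℂ := {p : ℂ | 0 ≤ p.re}

/-- `Gt p = ∫₀^∞ e^{-p t} G(t) dt` (as a convergent improper integral) for all `p` with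
`Re p > 0`.  On the line `Re p = 0` the value of a `Gt` that is continuous on the closed
half-plane is determined by this. -/
def IsLaplaceTransform (G : ℝ → ℂ) (Gt : ℂ → ℂ) : Prop :=
  ∀ p : ℂ, 0 < p.re →
    Tendsto (fun T : ℝ => ∫ t in (0 : ℝ)..T, Complex.exp (-p * (t : ℂ)) * G t) atTop (𝓝 (Gt p))

/-- The complex derivative `F'(p)`, one-sided (within `Re p ≥ 0`) at the points of the line
`Re p = 0`. -/
def hpDeriv (F : ℂ → ℂ) (p : ℂ) : ℂ := derivWithin F closedHalfPlane p

/-- `F` is twice continuously (complex) differentiable on the closed half-plane `Re p ≥ 0`, and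
its second derivative is bounded there. -/
def IsBoundedC2 (F : ℂ → ℂ) : Prop :=
  ContDiffOn ℂ 2 F closedHalfPlane ∧
  ∃ M : ℝ, ∀ p ∈ closedHalfPlane, ‖iteratedDerivWithin 2 F closedHalfPlane p‖ ≤ M

open Classical in
/-- The difference derivative `δF/δp (x, y)`. -/
def diffDeriv (F : ℂ → ℂ) (x y : ℂ) : ℂ :=
  if x = y then hpDeriv F x else (F x - F y) / (x - y)

/-- The function `f(A) = U diag(f(E_α)) U⁺` of a Hermitian matrix `A = U diag(E_α) U⁺`. -/
def matFun {N : ℕ} {A : Mat N} (hA : A.IsHermitian) (f : ℝ → ℂ) : Mat N :=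
  (hA.eigenvectorUnitary : Mat N) * Matrix.diagonal (fun α => f (hA.eigenvalues α)) *
    star (hA.eigenvectorUnitary : Mat N)

/-- The finite set of (distinct) eigenvalues of a Hermitian matrix. -/
def eigenvalueSet {N : ℕ} {A : Mat N} (hA : A.IsHermitian) : Finset ℝ :=
  Finset.univ.image hA.eigenvalues

open Classical in
/-- The spectral projector `Π_a` of a Hermitian matrix, so that `A = ∑ a Π_a`. -/
def specProj {N : ℕ} {A : Mat N} (hA : A.IsHermitian) (a : ℝ) : Mat N :=
  matFun hA (fun x => if x = a then 1 else 0)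

/-- The function `f(A₁, A₂, A₃)` of three Hermitian matrices with Feynman indices `2, 1, 3`:
`∑ f(a₁, a₂, a₃) Π_{a₃} Π_{a₁} Π_{a₂}`. -/
def feynman213 {N : ℕ} {A₁ A₂ A₃ : Mat N}
    (h₁ : A₁.IsHermitian) (h₂ : A₂.IsHermitian) (h₃ : A₃.IsHermitian)
    (f : ℝ → ℝ → ℝ → ℂ) : Mat N :=
  ∑ a₁ ∈ eigenvalueSet h₁, ∑ a₂ ∈ eigenvalueSet h₂, ∑ a₃ ∈ eigenvalueSet h₃,
    f a₁ a₂ a₃ • (specProj h₃ a₃ * specProj h₁ a₁ * specProj h₂ a₂)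

/-- `F(-i A)` for a Hermitian matrix `A`. -/
def funNegI {N : ℕ} {A : Mat N} (hA : A.IsHermitian) (F : ℂ → ℂ) : Mat N :=
  matFun hA (fun E => F (-Complex.I * (E : ℂ)))

/-- The Feynman-ordered expression `H₂ · (δF/δp)(-i H₀, -i H₀)` in which `H₂` has index `2`, the
first copy of `H₀` has index `1` and the second one has index `3`.  As `δF/δp` is symmetric,
reversing the ordering convention gives the same matrix. -/
def orderedDiff {N : ℕ} {H₀ H₂ : Mat N} (h₀ : H₀.IsHermitian) (h₂ : H₂.IsHermitian)
    (F : ℂ → ℂ) : Mat N :=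
  feynman213 h₂ h₀ h₀ (fun a b c =>
    (a : ℂ) * diffDeriv F (-Complex.I * (b : ℂ)) (-Complex.I * (c : ℂ)))

/-- `r = 1 - λ² G̃'(-i H₀)`. -/
def rMat {N : ℕ} {H₀ : Mat N} (h₀ : H₀.IsHermitian) (Gt : ℂ → ℂ) (lam : ℝ) : Mat N :=
  1 - ((lam ^ 2 : ℝ) : ℂ) • funNegI h₀ (hpDeriv Gt)

/-- `L = -G̃(-i H₀) + λ² (G̃'(-i H₀) G̃(-i H₀) + i H₂ (δG̃/δp)(-i H₀, -i H₀))`, with the last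
term Feynman-ordered. -/
def LMat {N : ℕ} {H₀ H₂ : Mat N} (h₀ : H₀.IsHermitian) (h₂ : H₂.IsHermitian)
    (Gt : ℂ → ℂ) (lam : ℝ) : Mat N :=
  -funNegI h₀ Gt + ((lam ^ 2 : ℝ) : ℂ) •
    (funNegI h₀ (hpDeriv Gt) * funNegI h₀ Gt + Complex.I • orderedDiff h₀ h₂ Gt)

end

end RWAModel

/-! The bath correlation function is the Fourier transform of a finite positive measure ν, the
push-forward of |g|² dk under ω. Put ε = λ² and H_λ = H₀ + λ²H₂. In an eigenbasis of H_λ the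
equation for V_λ splits into scalar Volterra equations x' = -ε (e^{iEt} G) * x, where E is the
eigenvalue attached to the row. Positivity of ν makes the kernel of positive type, so |x(t)| ≤
|x(0)| (`norm_le_of_volterra`). Hence the Laplace transform of x exists for Re p > 0 and equals x(0)
/ (p + ε G̃(p - iE)) (`laplace_volterra`).

After the rescaling p = εq, the function x(τ/ε) has transform x(0) / (q + G̃(εq - iE)). To first
order in ε this is x(0) / (q/r + G̃(-iE)) with r = 1 - ε G̃'(-iE), the transform of x(0) r e^{ℓτ}
with ℓ = -r G̃(-iE). The available bound on the difference is of order ε² without decay in q, so it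
cannot be inverted directly. Its second derivative in q is O(ε² |q|⁻²), which is integrable on a
vertical line, and two derivatives in q correspond to the factor τ². Fourier inversion therefore
bounds τ² times the error by C ε² e^{cτ}; this is why t > 0 is needed
(`norm_le_of_laplace_deriv_two`, `scalar_asymptotics`).

C and c do not depend on E, so E may be an eigenvalue of H_λ, and nothing need be known about how
eigenvectors vary with λ. Thus W_λ(t) is an explicit function of H_λ up to O(λ⁴). It remains to
expand around H₀: the Daletskii-Krein formula with a quadratic remainder turns G̃(-iH_λ) into
G̃(-iH₀) minus iλ² times the Feynman-ordered term, G̃'(-iH_λ) is needed only up to O(λ²) because it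
carries a factor λ², and the matrix exponential is locally Lipschitz. -/

namespace RWAModel

/-! ### Calculus on the closed right half-plane. -/

lemma convex_closedHalfPlane : Convex ℝ closedHalfPlane :=
  convex_halfSpace_re_ge 0

lemma uniqueDiffOn_closedHalfPlane : UniqueDiffOn ℂ closedHalfPlane := by
  apply uniqueDiffOn_convex_of_isRCLikeNormedField convex_closedHalfPlane
  refine ⟨1, mem_interior_iff_mem_nhds.2 ?_⟩
  filter_upwards [(isOpen_lt continuous_const Complex.continuous_re).mem_nhds
    (show (0 : ℝ) < (1 : ℂ).re by simp)] with z hz using le_of_lt hz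

lemma closedHalfPlane_mem_nhds {p : ℂ} (hp : 0 < p.re) : closedHalfPlane ∈ 𝓝 p := by
  filter_upwards [(isOpen_lt continuous_const Complex.continuous_re).mem_nhds hp]
    with z hz using le_of_lt hz

/-- `F` and its derivatives up to order two are bounded by `B` on the closed half-plane. -/
structure HasC2Bound (F F₁ F₂ : ℂ → ℂ) (B : ℝ) : Prop where
  deriv_within : ∀ p ∈ closedHalfPlane, HasDerivWithinAt F (F₁ p) closedHalfPlane p
  deriv_within_two : ∀ p ∈ closedHalfPlane, HasDerivWithinAt F₁ (F₂ p) closedHalfPlane p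
  bound : ∀ p ∈ closedHalfPlane, ‖F p‖ ≤ B
  bound_one : ∀ p ∈ closedHalfPlane, ‖F₁ p‖ ≤ B
  bound_two : ∀ p ∈ closedHalfPlane, ‖F₂ p‖ ≤ B

lemma IsBoundedC2.hasDerivWithinAt {F : ℂ → ℂ} (hF : IsBoundedC2 F) {p : ℂ}
    (hp : p ∈ closedHalfPlane) : HasDerivWithinAt F (hpDeriv F p) closedHalfPlane p :=
  ((hF.1.differentiableOn (by norm_num)) p hp).hasDerivWithinAt

lemma IsBoundedC2.hasDerivWithinAt_hpDeriv {F : ℂ → ℂ} (hF : IsBoundedC2 F) {p : ℂ}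
    (hp : p ∈ closedHalfPlane) :
    HasDerivWithinAt (hpDeriv F) (iteratedDerivWithin 2 F closedHalfPlane p)
      closedHalfPlane p := by
  have h : ContDiffOn ℂ 1 (hpDeriv F) closedHalfPlane :=
    hF.1.derivWithin uniqueDiffOn_closedHalfPlane (by norm_num)
  have h2 := ((h.differentiableOn (by norm_num)) p hp).hasDerivWithinAt
  rwa [show iteratedDerivWithin 2 F closedHalfPlane p = derivWithin (hpDeriv F) closedHalfPlane p by
    rw [iteratedDerivWithin_succ]
    apply derivWithin_congr
    · intro x hx
      rw [iteratedDerivWithin_one]; rfl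
    · rw [iteratedDerivWithin_one]; rfl]

/-- A function on the half-plane with `B`-Lipschitz derivative satisfies the first order Taylor
estimate. -/
lemma norm_taylor_one_le {F F₁ F₂ : ℂ → ℂ} {B : ℝ}
    (h1 : ∀ p ∈ closedHalfPlane, HasDerivWithinAt F (F₁ p) closedHalfPlane p)
    (h2 : ∀ p ∈ closedHalfPlane, HasDerivWithinAt F₁ (F₂ p) closedHalfPlane p)
    (hB : ∀ p ∈ closedHalfPlane, ‖F₂ p‖ ≤ B) {p q : ℂ}
    (hp : p ∈ closedHalfPlane) (hq : q ∈ closedHalfPlane) :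
    ‖F₁ q - F₁ p‖ ≤ B * ‖q - p‖ ∧ ‖F q - F p - F₁ p * (q - p)‖ ≤ B * ‖q - p‖ ^ 2 := by
  have hlip : ∀ z ∈ closedHalfPlane, ‖F₁ z - F₁ p‖ ≤ B * ‖z - p‖ := fun z hz =>
    convex_closedHalfPlane.norm_image_sub_le_of_norm_hasDerivWithin_le h2 hB hp hz
  refine ⟨hlip q hq, ?_⟩
  have hB0 : 0 ≤ B := (norm_nonneg _).trans (hB p hp)
  -- On this convex set the derivative of z ↦ F z - F₁ p * z is at most B‖q - p‖, so the mean value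
  -- inequality gives the quadratic remainder (with B instead of the sharp B/2).
  set s := closedHalfPlane ∩ Metric.closedBall p ‖q - p‖
  have hs : Convex ℝ s := convex_closedHalfPlane.inter (convex_closedBall _ _)
  have hd : ∀ z ∈ s, HasDerivWithinAt (fun z => F z - F₁ p * z) (F₁ z - F₁ p) s z := by
    intro z hz
    have := ((h1 z hz.1).mono (inter_subset_left : s ⊆ _)).sub
      ((hasDerivWithinAt_id z s).const_mul (F₁ p))
    rw [mul_one] at this
    exact this
  have hb : ∀ z ∈ s, ‖F₁ z - F₁ p‖ ≤ B * ‖q - p‖ := fun z hz =>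
    (hlip z hz.1).trans (by gcongr; simpa [dist_eq_norm] using hz.2)
  have := hs.norm_image_sub_le_of_norm_hasDerivWithin_le hd hb
    (show p ∈ s from ⟨hp, by simp⟩) (show q ∈ s from ⟨hq, by simp [dist_eq_norm]⟩)
  calc _ = ‖F q - F₁ p * q - (F p - F₁ p * p)‖ := by congr 1; ring
    _ ≤ _ := this
    _ = _ := by ring

lemma HasC2Bound.lipschitz {F F₁ F₂ : ℂ → ℂ} {B : ℝ} (h : HasC2Bound F F₁ F₂ B) {p q : ℂ}
    (hp : p ∈ closedHalfPlane) (hq : q ∈ closedHalfPlane) : ‖F₁ q - F₁ p‖ ≤ B * ‖q - p‖ :=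
  (norm_taylor_one_le h.deriv_within h.deriv_within_two h.bound_two hp hq).1

lemma HasC2Bound.taylor {F F₁ F₂ : ℂ → ℂ} {B : ℝ} (h : HasC2Bound F F₁ F₂ B) {p q : ℂ}
    (hp : p ∈ closedHalfPlane) (hq : q ∈ closedHalfPlane) :
    ‖F q - F p - F₁ p * (q - p)‖ ≤ B * ‖q - p‖ ^ 2 :=
  (norm_taylor_one_le h.deriv_within h.deriv_within_two h.bound_two hp hq).2

lemma HasC2Bound.nonneg {F F₁ F₂ : ℂ → ℂ} {B : ℝ} (h : HasC2Bound F F₁ F₂ B) : 0 ≤ B :=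
  (norm_nonneg _).trans (h.bound 0 (by simp [closedHalfPlane]))

/-- A bounded second derivative and boundedness of the function away from the imaginary axis
imply boundedness of the function and of its first derivative. -/
lemma IsBoundedC2.exists_hasC2Bound {F : ℂ → ℂ} (hF : IsBoundedC2 F) {K : ℝ}
    (hK : ∀ p : ℂ, 1 ≤ p.re → ‖F p‖ ≤ K) :
    ∃ B, HasC2Bound F (hpDeriv F) (iteratedDerivWithin 2 F closedHalfPlane) B := by
  obtain ⟨M, hM⟩ := hF.2
  have hM0 : 0 ≤ M := (norm_nonneg _).trans (hM 0 (by simp [closedHalfPlane]))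
  have hK0 : 0 ≤ K := (norm_nonneg _).trans (hK 1 (by simp))
  have key : ∀ p ∈ closedHalfPlane, ‖F p‖ ≤ 3 * K + 6 * M ∧ ‖hpDeriv F p‖ ≤ 4 * K + 7 * M := by
    intro p hp
    have hp' : 0 ≤ p.re := hp
    have m1 : p + 1 ∈ closedHalfPlane := by simp [closedHalfPlane]; linarith
    have m2 : p + 2 ∈ closedHalfPlane := by simp [closedHalfPlane]; linarith
    have t1 := (norm_taylor_one_le (fun _ => hF.hasDerivWithinAt)
      (fun _ => hF.hasDerivWithinAt_hpDeriv) hM hp m1).2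
    have t2 := (norm_taylor_one_le (fun _ => hF.hasDerivWithinAt)
      (fun _ => hF.hasDerivWithinAt_hpDeriv) hM hp m2).2
    have k1 := hK (p + 1) (by simp; linarith)
    have k2 := hK (p + 2) (by simp; linarith)
    simp only [add_sub_cancel_left, norm_one, one_pow, mul_one, Complex.norm_ofNat] at t1 t2
    have hFp : ‖F p‖ ≤ 3 * K + 6 * M := by
      -- The Taylor formulas at p + 1 and p + 2 are combined to eliminate F'(p); what remains are
      -- values with real part at least 1, covered by `hK`, and remainders of size M and 4M. This
      -- gives 3K + 2M + 4M.
      have e : F p = (2 * F (p + 1) - F (p + 2)) + ((F (p + 2) - F p - hpDeriv F p * 2)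
          - 2 * (F (p + 1) - F p - hpDeriv F p)) := by ring
      have n1 := norm_add_le (2 * F (p + 1) - F (p + 2)) ((F (p + 2) - F p - hpDeriv F p * 2)
          - 2 * (F (p + 1) - F p - hpDeriv F p))
      rw [← e] at n1
      have n2 := norm_sub_le (2 * F (p + 1)) (F (p + 2))
      have n3 := norm_sub_le (F (p + 2) - F p - hpDeriv F p * 2)
        (2 * (F (p + 1) - F p - hpDeriv F p))
      rw [norm_mul, Complex.norm_ofNat] at n2 n3
      linarith
    refine ⟨hFp, ?_⟩
    have e : hpDeriv F p = F (p + 1) - F p - (F (p + 1) - F p - hpDeriv F p) := by ring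
    have n1 := norm_sub_le (F (p + 1) - F p) (F (p + 1) - F p - hpDeriv F p)
    rw [← e] at n1
    have n2 := norm_sub_le (F (p + 1)) (F p)
    linarith
  exact ⟨4 * K + 7 * M, fun _ => hF.hasDerivWithinAt, fun _ => hF.hasDerivWithinAt_hpDeriv,
    fun p hp => (key p hp).1.trans (by linarith), fun p hp => (key p hp).2,
    fun p hp => (hM p hp).trans (by linarith)⟩

/-! ### Kernels of positive type and spectral measures. -/

/-- The correlation function `t ↦ ∫ e^{-iθt} dν(θ)` of a spectral measure `ν`. -/
noncomputable def spectralCorrelation (ν : Measure ℝ) (t : ℝ) : ℂ :=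
  ∫ θ, Complex.exp (-Complex.I * θ * t) ∂ν

lemma norm_exp_neg_I_mul (θ t : ℝ) : ‖Complex.exp (-Complex.I * θ * t)‖ = 1 := by
  have : -Complex.I * θ * t = ((-(θ * t) : ℝ) : ℂ) * Complex.I := by push_cast; ring
  rw [this, Complex.norm_exp_ofReal_mul_I]

lemma continuous_spectralCorrelation (ν : Measure ℝ) [IsFiniteMeasure ν] :
    Continuous (spectralCorrelation ν) := by
  refine continuous_of_dominated (bound := fun _ => 1) (fun t => ?_) (fun t => ?_)
    (integrable_const _) ?_
  · exact (by fun_prop : Continuous fun θ : ℝ =>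
      Complex.exp (-Complex.I * θ * t)).aestronglyMeasurable
  · exact ae_of_all _ fun θ => (norm_exp_neg_I_mul θ t).le
  · exact ae_of_all _ fun θ => by fun_prop

lemma norm_spectralCorrelation_le (ν : Measure ℝ) [IsFiniteMeasure ν] (t : ℝ) :
    ‖spectralCorrelation ν t‖ ≤ ν.real univ := by
  have := norm_integral_le_of_norm_le_const (μ := ν) (C := 1)
    (ae_of_all _ fun θ => (norm_exp_neg_I_mul θ t).le)
  simpa [spectralCorrelation] using this

/-- The measure with spectrum shifted by `E` has correlation function `e^{iEt} k(t)`. -/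
lemma spectralCorrelation_map_sub (ν : Measure ℝ) (E t : ℝ) :
    spectralCorrelation (ν.map (fun θ => θ - E)) t =
      Complex.exp (Complex.I * E * t) * spectralCorrelation ν t := by
  unfold spectralCorrelation
  rw [integral_map (by fun_prop) (by fun_prop), ← integral_const_mul]
  congr 1 with θ
  rw [← Complex.exp_add]
  congr 1
  push_cast; ring

lemma integrable_prod_of_continuous (ν : Measure ℝ) [IsFiniteMeasure ν] {E : Type*}
    [NormedAddCommGroup E] {f : ℝ → ℝ → E}
    (hf : Continuous fun z : ℝ × ℝ => f z.1 z.2) {a b C : ℝ}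
    (hC : ∀ s ∈ uIoc a b, ∀ θ, ‖f s θ‖ ≤ C) :
    Integrable (Function.uncurry f) ((volume.restrict (uIoc a b)).prod ν) := by
  have : IsFiniteMeasure (volume.restrict (uIoc a b)) := ⟨by
    rw [Measure.restrict_apply_univ, uIoc]; exact measure_Ioc_lt_top⟩
  refine Integrable.of_bound (C := C) (by exact hf.aestronglyMeasurable) ?_
  have h : ∀ᵐ z ∂(volume.restrict (uIoc a b)).prod ν, z.1 ∈ uIoc a b :=
    Measure.quasiMeasurePreserving_fst.ae (ae_restrict_mem measurableSet_uIoc)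
  filter_upwards [h] with z hz using hC _ hz _

/-- A solution of the Volterra equation `x' = -a ∫₀ᵗ k(t-s) x(s) ds` with a kernel of positive type
does not grow. -/
lemma norm_le_of_volterra (ν : Measure ℝ) [IsFiniteMeasure ν] {a : ℝ} (ha : 0 ≤ a) {x : ℝ → ℂ}
    (hxc : Continuous x)
    (hx : ∀ t, 0 < t → HasDerivAt x
      (-(a * ∫ s in (0 : ℝ)..t, spectralCorrelation ν (t - s) * x s)) t)
    {T : ℝ} (hT : 0 ≤ T) : ‖x T‖ ≤ ‖x 0‖ := by
  have hc : ∀ θ : ℝ, Continuous fun s : ℝ => Complex.exp (Complex.I * θ * s) * x s :=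
    fun θ => by fun_prop
  have hn : ∀ θ s : ℝ, ‖Complex.exp (Complex.I * θ * s)‖ = 1 := fun θ s => by
    simpa using norm_exp_neg_I_mul (-θ) s
  -- Energy identity: the derivative of ‖x‖² is -a ∫ (d/dt)‖Y θ t‖² dν(θ), and Y θ 0 = 0, so ‖x T‖²
  -- = ‖x 0‖² - a ∫ ‖Y θ T‖² dν(θ). This is where positivity of ν enters.
  set Y : ℝ → ℝ → ℂ := fun θ t => ∫ s in (0 : ℝ)..t, Complex.exp (Complex.I * θ * s) * x s with hY
  have hYc : Continuous fun z : ℝ × ℝ => Y z.2 z.1 :=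
    intervalIntegral.continuous_parametric_intervalIntegral_of_continuous (a₀ := 0)
      (f := fun z : ℝ × ℝ => fun s : ℝ => Complex.exp (Complex.I * z.2 * s) * x s)
      (by fun_prop) continuous_fst
  have hYd : ∀ θ t : ℝ, HasDerivAt (Y θ) (Complex.exp (Complex.I * θ * t) * x t) t := fun θ t =>
    (hc θ).integral_hasStrictDerivAt 0 t |>.hasDerivAt
  obtain ⟨M, hM⟩ := isCompact_Icc.exists_bound_of_continuousOn (s := Icc 0 T) hxc.continuousOn
  have hM0 : 0 ≤ M := (norm_nonneg _).trans (hM 0 ⟨le_rfl, hT⟩)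
  have hYb : ∀ θ, ∀ t ∈ Icc 0 T, ‖Y θ t‖ ≤ M * T := by
    intro θ t ht
    have := intervalIntegral.norm_integral_le_of_norm_le_const (a := 0) (b := t) (C := M)
      (f := fun s : ℝ => Complex.exp (Complex.I * θ * s) * x s) (fun s hs => by
        rw [uIoc_of_le ht.1] at hs
        rw [norm_mul, hn, one_mul]
        exact hM s ⟨hs.1.le, hs.2.trans ht.2⟩)
    refine this.trans ?_
    rw [sub_zero, abs_of_nonneg ht.1]
    gcongr
    exact ht.2
  have hconv : ∀ t ∈ Icc 0 T, ∫ s in (0 : ℝ)..t, spectralCorrelation ν (t - s) * x s =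
      ∫ θ, Complex.exp (-Complex.I * θ * t) * Y θ t ∂ν := by
    intro t ht
    have h1 : ∀ s : ℝ, spectralCorrelation ν (t - s) * x s =
        ∫ θ, Complex.exp (-Complex.I * θ * t) * (Complex.exp (Complex.I * θ * s) * x s) ∂ν := by
      intro s
      rw [spectralCorrelation, ← integral_mul_const]
      congr 1 with θ
      rw [← mul_assoc, ← Complex.exp_add]
      congr 2
      push_cast; ring
    simp_rw [h1]
    rw [intervalIntegral_integral_swap]
    · congr 1 with θ
      rw [hY, intervalIntegral.integral_const_mul]
    · refine integrable_prod_of_continuous ν (C := M) (by fun_prop) fun s hs θ => ?_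
      rw [uIoc_of_le ht.1] at hs
      rw [norm_mul, norm_mul, hn, norm_exp_neg_I_mul, one_mul, one_mul]
      exact hM s ⟨hs.1.le, hs.2.trans ht.2⟩
  have hinner : ∀ t ∈ Icc 0 T,
      2 * inner ℝ (x t) (-(a * ∫ s in (0 : ℝ)..t, spectralCorrelation ν (t - s) * x s)) =
      -a * ∫ θ, 2 * inner ℝ (Y θ t) (Complex.exp (Complex.I * θ * t) * x t) ∂ν := by
    intro t ht
    have hint : Integrable (fun θ : ℝ => Complex.exp (-Complex.I * θ * t) * Y θ t) ν := by
      refine Integrable.of_bound (C := M * T) ?_ (ae_of_all _ fun θ => ?_)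
      · have : Continuous fun θ : ℝ => Y θ t := hYc.comp (Continuous.prodMk continuous_const continuous_id)
        exact (by fun_prop : Continuous fun θ : ℝ =>
          Complex.exp (-Complex.I * θ * t) * Y θ t).aestronglyMeasurable
      · rw [norm_mul, norm_exp_neg_I_mul, one_mul]
        exact hYb θ t ht
    rw [hconv t ht, integral_const_mul]
    have h1 : (-((a : ℂ) * ∫ θ, Complex.exp (-Complex.I * θ * t) * Y θ t ∂ν)) =
        (-a) • ∫ θ, Complex.exp (-Complex.I * θ * t) * Y θ t ∂ν := by
      rw [Complex.real_smul]; push_cast; ring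
    rw [h1, inner_smul_right, ← integral_inner hint]
    have h2 : ∀ θ : ℝ, inner ℝ (x t) (Complex.exp (-Complex.I * θ * t) * Y θ t) =
        inner ℝ (Y θ t) (Complex.exp (Complex.I * θ * t) * x t) := by
      intro θ
      rw [real_inner_comm]
      simp only [Complex.inner, map_mul, ← Complex.exp_conj, Complex.conj_I, Complex.conj_ofReal,
        map_neg, neg_neg]
      congr 1; ring
    simp_rw [h2]
    ring
  have hYint : ∀ θ, ∫ t in (0 : ℝ)..T, 2 * inner ℝ (Y θ t) (Complex.exp (Complex.I * θ * t) * x t) =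
      ‖Y θ T‖ ^ 2 := by
    intro θ
    have hYθ : Continuous (Y θ) := hYc.comp (Continuous.prodMk continuous_id continuous_const)
    rw [intervalIntegral.integral_eq_sub_of_hasDerivAt (fun t _ => (hYd θ t).norm_sq)
      (by apply Continuous.intervalIntegrable; fun_prop)]
    simp [hY]
  have hcontinner : Continuous fun z : ℝ × ℝ =>
      2 * inner ℝ (Y z.2 z.1) (Complex.exp (Complex.I * z.2 * z.1) * x z.1) := by fun_prop
  have hprod : Integrable (Function.uncurry fun t θ : ℝ =>
      2 * inner ℝ (Y θ t) (Complex.exp (Complex.I * θ * t) * x t))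
      ((volume.restrict (uIoc 0 T)).prod ν) := by
    refine integrable_prod_of_continuous ν (C := 2 * ((M * T) * M)) hcontinner fun t ht θ => ?_
    rw [uIoc_of_le hT] at ht
    have ht' : t ∈ Icc 0 T := ⟨ht.1.le, ht.2⟩
    rw [norm_mul, Real.norm_ofNat]
    have := norm_inner_le_norm (𝕜 := ℝ) (Y θ t) (Complex.exp (Complex.I * θ * t) * x t)
    rw [norm_mul, hn, one_mul] at this
    have h3 := mul_le_mul (hYb θ t ht') (hM t ht') (norm_nonneg _) (by positivity)
    linarith
  have hFTC := intervalIntegral.integral_eq_sub_of_hasDerivAt_of_le hT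
    (f := fun t => ‖x t‖ ^ 2)
    (f' := fun t => -a * ∫ θ, 2 * inner ℝ (Y θ t) (Complex.exp (Complex.I * θ * t) * x t) ∂ν)
    (by fun_prop) (fun t ht => by
      have := (hx t ht.1).norm_sq
      rwa [hinner t ⟨ht.1.le, ht.2.le⟩] at this)
    (by
      refine IntervalIntegrable.const_mul ?_ _
      rw [intervalIntegrable_iff]
      exact hprod.integral_prod_left)
  rw [intervalIntegral.integral_const_mul, intervalIntegral_integral_swap hprod] at hFTC
  simp_rw [hYint] at hFTC
  have hpos : 0 ≤ ∫ θ, ‖Y θ T‖ ^ 2 ∂ν := integral_nonneg fun θ => by positivity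
  have : ‖x T‖ ^ 2 ≤ ‖x 0‖ ^ 2 := by nlinarith
  exact le_of_sq_le_sq this (norm_nonneg _)

/-- The bath correlation function is the correlation function of a finite spectral measure. -/
lemma BathAdmissible.exists_spectralCorrelation {g : ℝ → ℂ} {ω : ℝ → ℝ}
    (h : BathAdmissible g ω) :
    ∃ ν : Measure ℝ, IsFiniteMeasure ν ∧
      ∀ t, bathCorrelation g ω t = spectralCorrelation ν t := by
  have h0 : Integrable fun k : ℝ => ‖g k‖ ^ 2 := by
    have := (h.1 0 le_rfl).norm
    simpa using this
  set d : ℝ → NNReal := fun k => ‖g k‖₊ ^ 2 with hd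
  have hdm : AEMeasurable d := by
    have := h0.1.aemeasurable.real_toNNReal
    refine this.congr (ae_of_all _ fun k => ?_)
    ext; simp [hd]
  set μ : Measure ℝ := volume.withDensity fun k => (d k : ENNReal) with hμ
  have hfin : IsFiniteMeasure μ := by
    refine isFiniteMeasure_withDensity ?_
    have := h0.2
    rw [HasFiniteIntegral] at this
    refine (lt_of_eq_of_lt (lintegral_congr fun k => ?_) this).ne
    rw [enorm_eq_nnnorm]
    congr 1; ext; simp [hd]
  -- Allows division by |g|², which isolates the phase in the integrand.
  have hne : ∀ᵐ k ∂μ, g k ≠ 0 := by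
    rw [hμ, ae_withDensity_iff' (by fun_prop)]
    refine ae_of_all _ fun k hk => ?_
    rintro h; simp [hd, h] at hk
  have hexp : ∀ t : ℝ, 0 ≤ t → AEMeasurable (fun k => Complex.exp (-Complex.I * ω k * t)) μ := by
    intro t ht
    have h1 : AEMeasurable (fun k : ℝ =>
        ((‖g k‖ ^ 2 : ℝ) : ℂ) * Complex.exp (-Complex.I * (ω k : ℂ) * (t : ℂ))) μ :=
      (h.1 t ht).1.aemeasurable.mono_ac (withDensity_absolutelyContinuous _ _)
    have h2 : AEMeasurable (fun k : ℝ => ((‖g k‖ ^ 2 : ℝ) : ℂ)) μ :=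
      (Complex.measurable_ofReal.comp_aemeasurable h0.1.aemeasurable).mono_ac
        (withDensity_absolutelyContinuous _ _)
    refine (h1.div h2).congr ?_
    filter_upwards [hne] with k hk
    have : ((‖g k‖ ^ 2 : ℝ) : ℂ) ≠ 0 := by simpa using hk
    exact mul_div_cancel_left₀ _ this
  -- Measurability of ω is not assumed. It is recovered where g ≠ 0 from the phases at small times,
  -- as ω is the limit of -n Im e^{-iω/n}.
  have hω : AEMeasurable ω μ := by
    refine aemeasurable_of_tendsto_metrizable_ae' (f := fun (n : ℕ) k =>
      -((n : ℝ) + 1) * (Complex.exp (-Complex.I * ω k * ((1 / ((n : ℝ) + 1) : ℝ) : ℂ))).im)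
      (fun n => ?_) (ae_of_all _ fun k => ?_)
    · exact (Complex.measurable_im.comp_aemeasurable (hexp _ (by positivity))).const_mul _
    · have h1 : HasDerivAt (fun x : ℝ => Real.sin (ω k * x)) (ω k) 0 := by
        have := (Real.hasDerivAt_sin (ω k * 0)).comp (0 : ℝ) ((hasDerivAt_id (0 : ℝ)).const_mul (ω k))
        rw [mul_zero, Real.cos_zero, one_mul, mul_one] at this
        exact this
      have h2 := h1.tendsto_slope_zero_right
      have h3 : Tendsto (fun n : ℕ => 1 / ((n : ℝ) + 1)) atTop (𝓝[>] 0) :=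
        tendsto_nhdsWithin_iff.2 ⟨tendsto_one_div_add_atTop_nhds_zero_nat,
          Eventually.of_forall fun n => by simp only [mem_Ioi]; positivity⟩
      refine (h2.comp h3).congr fun n => ?_
      have e : -Complex.I * ω k * ((1 / ((n : ℝ) + 1) : ℝ) : ℂ)
          = ((-(ω k * (1 / ((n : ℝ) + 1))) : ℝ) : ℂ) * Complex.I := by push_cast; ring
      rw [e, Complex.exp_ofReal_mul_I_im]
      simp
      ring
  refine ⟨μ.map ω, inferInstance, fun t => ?_⟩
  rw [spectralCorrelation, integral_map hω (by fun_prop), hμ,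
    integral_withDensity_eq_integral_smul₀ hdm]
  refine integral_congr_ae (ae_of_all _ fun k => ?_)
  simp [hd, NNReal.smul_def]

/-! ### Laplace transform of the Volterra equation and its inversion. -/

section

open scoped FourierTransform Real

lemma norm_exp_neg_mul (p : ℂ) (t : ℝ) : ‖Complex.exp (-p * t)‖ = Real.exp (-p.re * t) := by
  simp [Complex.norm_exp]

/-- A bounded continuous function has an absolutely convergent Laplace integral. -/
lemma integrableOn_laplace {x : ℝ → ℂ} (hxc : Continuous x) {M : ℝ}
    (hM : ∀ t, 0 ≤ t → ‖x t‖ ≤ M) {p : ℂ} (hp : 0 < p.re) :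
    IntegrableOn (fun t : ℝ => Complex.exp (-p * t) * x t) (Ioi 0) := by
  have h := (exp_neg_integrableOn_Ioi 0 hp).const_mul M
  refine Integrable.mono' h (by fun_prop) ?_
  filter_upwards [ae_restrict_mem measurableSet_Ioi] with t ht
  rw [norm_mul, norm_exp_neg_mul, mul_comm]
  gcongr
  exact hM t (le_of_lt ht)

/-- The Laplace transform of the solution of a Volterra equation with kernel of positive type. -/
lemma laplace_volterra (ν : Measure ℝ) [IsFiniteMeasure ν] {a : ℝ} (ha : 0 ≤ a) {x : ℝ → ℂ}
    (hxc : Continuous x)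
    (hx : ∀ t, 0 < t → HasDerivAt x
      (-(a * ∫ s in (0 : ℝ)..t, spectralCorrelation ν (t - s) * x s)) t)
    {p : ℂ} (hp : 0 < p.re) :
    (p + a * ∫ t in Ioi (0 : ℝ), Complex.exp (-p * t) * spectralCorrelation ν t) *
      (∫ t in Ioi (0 : ℝ), Complex.exp (-p * t) * x t) = x 0 := by
  have hb : ∀ t, 0 ≤ t → ‖x t‖ ≤ ‖x 0‖ := fun t ht => norm_le_of_volterra ν ha hxc hx ht
  have hix := integrableOn_laplace hxc hb hp
  have hik := integrableOn_laplace (continuous_spectralCorrelation ν)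
    (fun t _ => norm_spectralCorrelation_le ν t) hp
  have hconv := integral_posConvolution (μ := volume) (ν := volume) hix hik
    (ContinuousLinearMap.mul ℝ ℂ)
  have hiconv := (integrable_posConvolution (μ := volume) (ν := volume) hix hik
    (ContinuousLinearMap.mul ℝ ℂ)).integrableOn (s := Ioi 0)
  have heq : ∀ t : ℝ, ∫ s in (0 : ℝ)..t, (ContinuousLinearMap.mul ℝ ℂ)
      (Complex.exp (-p * s) * x s)
        (Complex.exp (-p * (t - s : ℝ)) * spectralCorrelation ν (t - s)) =
      Complex.exp (-p * t) * ∫ s in (0 : ℝ)..t, spectralCorrelation ν (t - s) * x s := by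
    intro t
    rw [← intervalIntegral.integral_const_mul]
    congr 1 with s
    have : Complex.exp (-p * t) = Complex.exp (-p * s) * Complex.exp (-p * (t - s : ℝ)) := by
      rw [← Complex.exp_add]; congr 1; push_cast; ring
    rw [this, ContinuousLinearMap.mul_apply']
    ring
  have hiconv' : IntegrableOn (fun t : ℝ => Complex.exp (-p * t) *
      ∫ s in (0 : ℝ)..t, spectralCorrelation ν (t - s) * x s) (Ioi 0) := by
    refine hiconv.congr_fun (fun t ht => ?_) measurableSet_Ioi
    rw [← heq, posConvolution, indicator_of_mem ht]
  simp_rw [heq] at hconv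
  -- Integrated over `Ioi 0`, this becomes the algebraic equation for the transform; the boundary
  -- term at infinity vanishes because x is bounded by ‖x 0‖.
  have hderiv : ∀ t ∈ Ioi (0 : ℝ), HasDerivAt (fun t : ℝ => Complex.exp (-p * t) * x t)
      (-p * (Complex.exp (-p * t) * x t) + -a * (Complex.exp (-p * t) *
        ∫ s in (0 : ℝ)..t, spectralCorrelation ν (t - s) * x s)) t := by
    intro t ht
    have h1 : HasDerivAt (fun t : ℝ => Complex.exp (-p * t)) (Complex.exp (-p * t) * -p) t := by
      have := ((hasDerivAt_id (t : ℂ)).const_mul (-p)).cexp.comp_ofReal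
      simpa using this
    exact (h1.fun_mul (hx t ht)).congr_deriv (by ring)
  have htend : Tendsto (fun t : ℝ => Complex.exp (-p * t) * x t) atTop (𝓝 0) := by
    have h0 : Tendsto (fun t : ℝ => Real.exp (-p.re * t) * ‖x 0‖) atTop (𝓝 0) := by
      have h1 : Tendsto (fun t : ℝ => -p.re * t) atTop atBot :=
        tendsto_id.const_mul_atTop_of_neg (by linarith)
      simpa using (Real.tendsto_exp_atBot.comp h1).mul_const ‖x 0‖
    refine squeeze_zero_norm' ?_ h0
    filter_upwards [eventually_ge_atTop 0] with t ht
    rw [norm_mul, norm_exp_neg_mul]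
    gcongr
    exact hb t ht
  have hI := integral_Ioi_of_hasDerivAt_of_tendsto
    (by fun_prop : Continuous fun t : ℝ => Complex.exp (-p * t) * x t).continuousWithinAt hderiv
    ((hix.const_mul (-p)).add (hiconv'.const_mul (-(a : ℂ)))) htend
  rw [integral_add (hix.const_mul (-p)) (hiconv'.const_mul (-(a : ℂ))), integral_const_mul,
    integral_const_mul, hconv, ContinuousLinearMap.mul_apply'] at hI
  simp only [Complex.ofReal_zero, mul_zero, Complex.exp_zero, one_mul, zero_sub] at hI
  linear_combination -hI

/-- A bound on a function through the second derivative of its Laplace transform on a vertical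
line. -/
lemma norm_le_of_laplace_deriv_two {d : ℝ → ℂ} (hdc : Continuous d) {c K : ℝ}
    (hd : ∀ t, 0 ≤ t → ‖d t‖ ≤ K * Real.exp ((c - 1) * t)) {D D₁ D₂ : ℝ → ℂ}
    (hD : ∀ ξ : ℝ, ∫ t in Ioi (0 : ℝ), Complex.exp (-(c + 2 * π * ξ * Complex.I) * t) * d t = D ξ)
    (h₁ : ∀ ξ, HasDerivAt D (D₁ ξ) ξ) (h₂ : ∀ ξ, HasDerivAt D₁ (D₂ ξ) ξ) {S : ℝ}
    (hS : ∀ ξ, ‖D₂ ξ‖ ≤ S * (1 + ξ ^ 2)⁻¹) {t : ℝ} (ht : 0 < t) :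
    t ^ 2 * ‖d t‖ ≤ S * Real.exp (c * t) := by
  -- The Fourier transform of f at ξ is the Laplace transform of d on the line Re = c, and D₂ is the
  -- Fourier transform of (-2πit)² f.
  set f : ℝ → ℂ := (Ioi 0).indicator fun t : ℝ => Complex.exp (-c * t) * d t with hf
  have hfn : ∀ n : ℕ, Integrable fun t : ℝ => t ^ n • f t := by
    intro n
    have h : (fun t : ℝ => t ^ n • f t) =
        (Ioi 0).indicator fun t : ℝ => t ^ n • (Complex.exp (-c * t) * d t) := by
      ext t; by_cases ht : t ∈ Ioi (0 : ℝ) <;> simp [hf, ht]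
    rw [h, integrable_indicator_iff measurableSet_Ioi]
    -- The gap 1 between the growth rate c - 1 of d and the abscissa c leaves e^{-t}, so t^n f is
    -- dominated by a Gamma integrand.
    have hG := (Real.GammaIntegral_convergent (s := n + 1) (by positivity)).const_mul K
    refine Integrable.mono' hG (by fun_prop) ?_
    filter_upwards [ae_restrict_mem measurableSet_Ioi] with t ht
    have ht' : 0 < t := ht
    have e : ‖Complex.exp (-c * t)‖ = Real.exp (-c * t) := norm_exp_neg_mul c t
    rw [norm_smul, norm_mul, e, add_sub_cancel_right, Real.rpow_natCast, norm_pow,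
      Real.norm_of_nonneg ht'.le]
    calc t ^ n * (Real.exp (-c * t) * ‖d t‖)
        ≤ t ^ n * (Real.exp (-c * t) * (K * Real.exp ((c - 1) * t))) := by
          gcongr; exact hd t ht'.le
      _ = K * ((Real.exp (-c * t) * Real.exp ((c - 1) * t)) * t ^ n) := by ring
      _ = _ := by rw [← Real.exp_add]; ring_nf
  have hfi : Integrable f := by simpa using hfn 0
  have hFf : 𝓕 f = D := by
    ext ξ
    rw [Real.fourier_real_eq_integral_exp_smul, ← hD, ← integral_indicator measurableSet_Ioi]
    congr 1 with t
    by_cases ht : t ∈ Ioi (0 : ℝ)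
    · simp only [hf, indicator_of_mem ht, smul_eq_mul]
      rw [← mul_assoc, ← Complex.exp_add]
      congr 2
      push_cast; ring
    · simp [hf, ht]
  have hF2 : 𝓕 (fun t : ℝ => (-2 * π * Complex.I * t) ^ 2 • f t) = D₂ := by
    have h := Real.iteratedDeriv_fourier (f := f) (N := 2) (n := 2) (fun n _ => hfn n) le_rfl
    rw [← h, hFf, iteratedDeriv_succ, iteratedDeriv_one, deriv_eq h₁, deriv_eq h₂]
  set h : ℝ → ℂ := fun t : ℝ => (-2 * π * Complex.I * t) ^ 2 • f t with hh
  have hhi : Integrable h := by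
    refine ((hfn 2).const_mul ((-2 * π * Complex.I) ^ 2)).congr (ae_of_all _ fun t => ?_)
    simp only [hh, smul_eq_mul, Complex.real_smul]
    push_cast; ring
  have hSi : Integrable fun ξ : ℝ => S * (1 + ξ ^ 2)⁻¹ := integrable_inv_one_add_sq.const_mul S
  have hD2i : Integrable D₂ := by
    refine hSi.mono' ?_ (ae_of_all _ hS)
    have : D₂ = deriv D₁ := (deriv_eq h₂).symm
    rw [this]
    exact (stronglyMeasurable_deriv D₁).aestronglyMeasurable
  -- Pointwise inversion needs continuity only at the given t > 0, so the cut-off at 0 does no harm.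
  have hcont : ContinuousAt h t := by
    have h1 : (fun t : ℝ => (-2 * π * Complex.I * t) ^ 2 • (Complex.exp (-c * t) * d t)) =ᶠ[𝓝 t] h := by
      filter_upwards [Ioi_mem_nhds ht] with s hs
      simp only [hh, hf, indicator_of_mem hs]
    exact (by fun_prop : Continuous fun t : ℝ =>
      (-2 * π * Complex.I * t) ^ 2 • (Complex.exp (-c * t) * d t)).continuousAt.congr h1
  have hinv := hhi.fourierInv_fourier_eq (by rwa [hF2]) hcont
  rw [hF2, Real.fourierInv_eq'] at hinv
  have hnorm : ‖h t‖ ≤ S * π := by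
    have hSπ : ∫ ξ : ℝ, S * (1 + ξ ^ 2)⁻¹ = S * π := by
      rw [integral_const_mul, integral_univ_inv_one_add_sq]
    rw [← hinv, ← hSπ]
    refine norm_integral_le_of_norm_le hSi (ae_of_all _ fun ξ => ?_)
    rw [norm_smul, Complex.norm_exp_ofReal_mul_I, one_mul]
    exact hS ξ
  have e : ‖Complex.exp (-c * t)‖ = Real.exp (-c * t) := norm_exp_neg_mul c t
  have hval : ‖h t‖ = 4 * π ^ 2 * t ^ 2 * (Real.exp (-c * t) * ‖d t‖) := by
    simp only [hh, hf, indicator_of_mem (show t ∈ Ioi (0 : ℝ) from ht), norm_smul, norm_mul, e,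
      norm_pow, norm_neg, Complex.norm_ofNat, Complex.norm_real, Complex.norm_I,
      Real.norm_of_nonneg ht.le, Real.norm_of_nonneg Real.pi_pos.le]
    ring
  rw [hval] at hnorm
  have hpi := Real.pi_gt_three
  have hX : 0 ≤ t ^ 2 * (Real.exp (-c * t) * ‖d t‖) := by positivity
  -- The factor 4π² from differentiation beats the π from ∫ (1 + ξ²)⁻¹ dξ.
  have h3 : t ^ 2 * (Real.exp (-c * t) * ‖d t‖) ≤ S := by
    have : π * (4 * π * (t ^ 2 * (Real.exp (-c * t) * ‖d t‖))) ≤ π * S := by linarith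
    have := le_of_mul_le_mul_left this Real.pi_pos
    nlinarith
  calc t ^ 2 * ‖d t‖ = t ^ 2 * ((Real.exp (-c * t) * Real.exp (c * t)) * ‖d t‖) := by
        rw [← Real.exp_add]; simp
    _ = t ^ 2 * (Real.exp (-c * t) * ‖d t‖) * Real.exp (c * t) := by ring
    _ ≤ _ := by gcongr

end

/-! ### Comparison of resolvents and the scalar asymptotics. -/

section

open scoped FourierTransform Real

/-- The Laplace integral of the correlation function of an admissible bath. -/
lemma IsLaplaceTransform.eq_integral {ν : Measure ℝ} [IsFiniteMeasure ν] {F : ℂ → ℂ}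
    (h : IsLaplaceTransform (spectralCorrelation ν) F) {p : ℂ} (hp : 0 < p.re) :
    ∫ t in Ioi (0 : ℝ), Complex.exp (-p * t) * spectralCorrelation ν t = F p :=
  tendsto_nhds_unique (intervalIntegral_tendsto_integral_Ioi 0
    (integrableOn_laplace (continuous_spectralCorrelation ν)
      (fun t _ => norm_spectralCorrelation_le ν t) hp) tendsto_id) (h p hp)

/-- For Re p ≥ 1 the integrand is dominated by ν(ℝ) e^{-t}. This supplies the bound away from the
imaginary axis required by `IsBoundedC2.exists_hasC2Bound`. -/
lemma IsLaplaceTransform.norm_le {ν : Measure ℝ} [IsFiniteMeasure ν] {F : ℂ → ℂ}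
    (h : IsLaplaceTransform (spectralCorrelation ν) F) {p : ℂ} (hp : 1 ≤ p.re) :
    ‖F p‖ ≤ ν.real univ := by
  rw [← h.eq_integral (by linarith)]
  have hI : ∫ t in Ioi (0 : ℝ), ν.real univ * Real.exp (-t) = ν.real univ := by
    rw [integral_const_mul, integral_exp_neg_Ioi_zero, mul_one]
  rw [← hI]
  refine norm_integral_le_of_norm_le ((integrableOn_exp_neg_Ioi 0).const_mul _) ?_
  filter_upwards [ae_restrict_mem measurableSet_Ioi] with t ht
  have ht' : 0 < t := ht
  rw [norm_mul, norm_exp_neg_mul, mul_comm]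
  gcongr
  · exact norm_spectralCorrelation_le ν t
  · nlinarith

/-- The effect of a shift of the spectrum on the Laplace transform. -/
lemma IsLaplaceTransform.eq_integral_map_sub {ν : Measure ℝ} [IsFiniteMeasure ν] {F : ℂ → ℂ}
    (h : IsLaplaceTransform (spectralCorrelation ν) F) (E : ℝ) {p : ℂ} (hp : 0 < p.re) :
    ∫ t in Ioi (0 : ℝ), Complex.exp (-p * t) *
      spectralCorrelation (ν.map (fun θ => θ - E)) t = F (p - Complex.I * E) := by
  rw [← h.eq_integral (by simpa using hp)]
  congr 1 with t
  rw [spectralCorrelation_map_sub, ← mul_assoc, ← Complex.exp_add]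
  congr 2
  ring

/-- Comparison of the second derivatives `2 (A')² A⁻³ - A'' A⁻²` of two reciprocals, the second
one of an affine function with slope `R`; here `a = A⁻¹`, `b = A₀⁻¹`. -/
lemma norm_sub_deriv_two_inv_le {A A₀ A₁ A₂ R : ℂ} {m δ : ℝ} (hm : 0 < m)
    (hA : m / 2 ≤ ‖A‖) (hA₀ : m / 2 ≤ ‖A₀‖) (hA₁ : ‖A₁‖ ≤ 2) (hR : ‖R‖ ≤ 2)
    (h₀ : ‖A - A₀‖ ≤ δ * m ^ 2) (h₁ : ‖A₁ - R‖ ≤ δ * m) (h₂ : ‖A₂‖ ≤ δ) :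
    ‖(2 * A₁ ^ 2 / A ^ 3 - A₂ / A ^ 2) - 2 * R ^ 2 / A₀ ^ 3‖ ≤ 500 * δ * (m⁻¹) ^ 2 := by
  have hδ : 0 ≤ δ := (norm_nonneg _).trans h₂
  have hAne : A ≠ 0 := norm_pos_iff.1 (by linarith)
  have hA₀ne : A₀ ≠ 0 := norm_pos_iff.1 (by linarith)
  have ha : ‖A⁻¹‖ ≤ 2 * m⁻¹ := by
    rw [norm_inv]
    calc ‖A‖⁻¹ ≤ (m / 2)⁻¹ := by gcongr
      _ = 2 * m⁻¹ := by field_simp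
  have hb : ‖A₀⁻¹‖ ≤ 2 * m⁻¹ := by
    rw [norm_inv]
    calc ‖A₀‖⁻¹ ≤ (m / 2)⁻¹ := by gcongr
      _ = 2 * m⁻¹ := by field_simp
  -- Each term contains one small difference, using a³ - b³ = (a - b)(a² + ab + b²) and a - b = -(A
  -- - A₀)ab. The allowed growth δm², δm, δ of the three differences is just what the powers of a
  -- and b reduce to δm⁻².
  have e : (2 * A₁ ^ 2 / A ^ 3 - A₂ / A ^ 2) - 2 * R ^ 2 / A₀ ^ 3 =
      2 * ((A₁ - R) * (A₁ + R)) * A⁻¹ ^ 3 - A₂ * A⁻¹ ^ 2 -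
        2 * R ^ 2 * ((A - A₀) * (A⁻¹ * A₀⁻¹) * (A⁻¹ ^ 2 + A⁻¹ * A₀⁻¹ + A₀⁻¹ ^ 2)) := by
    field_simp; ring
  set a := A⁻¹
  set b := A₀⁻¹
  have hsum : ‖a ^ 2 + a * b + b ^ 2‖ ≤ 12 * m⁻¹ ^ 2 := by
    calc ‖a ^ 2 + a * b + b ^ 2‖ ≤ ‖a‖ ^ 2 + ‖a‖ * ‖b‖ + ‖b‖ ^ 2 := by
          refine (norm_add₃_le).trans ?_
          simp
      _ ≤ (2 * m⁻¹) ^ 2 + (2 * m⁻¹) * (2 * m⁻¹) + (2 * m⁻¹) ^ 2 := by gcongr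
      _ = _ := by ring
  have hplus : ‖A₁ + R‖ ≤ 4 := (norm_add_le _ _).trans (by linarith)
  rw [e]
  calc _ ≤ ‖2 * ((A₁ - R) * (A₁ + R)) * a ^ 3‖ + ‖A₂ * a ^ 2‖ +
        ‖2 * R ^ 2 * ((A - A₀) * (a * b) * (a ^ 2 + a * b + b ^ 2))‖ :=
        (norm_sub_le _ _).trans (by gcongr; exact norm_sub_le _ _)
    _ = 2 * (‖A₁ - R‖ * ‖A₁ + R‖) * ‖a‖ ^ 3 + ‖A₂‖ * ‖a‖ ^ 2 +
        2 * ‖R‖ ^ 2 * (‖A - A₀‖ * (‖a‖ * ‖b‖) * ‖a ^ 2 + a * b + b ^ 2‖) := by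
        simp only [norm_mul, norm_pow, Complex.norm_ofNat]
    _ ≤ 2 * ((δ * m) * 4) * (2 * m⁻¹) ^ 3 + δ * (2 * m⁻¹) ^ 2 +
        2 * 2 ^ 2 * ((δ * m ^ 2) * ((2 * m⁻¹) * (2 * m⁻¹)) * (12 * m⁻¹ ^ 2)) := by gcongr
    _ = 452 * δ * (m⁻¹) ^ 2 := by field_simp; ring
    _ ≤ _ := by gcongr; norm_num

/-- The Laplace transform of `t ↦ r e^{t ℓ}`. -/
lemma integral_exp_mul_exp {q ℓ : ℂ} (h : 0 < (q - ℓ).re) (r : ℂ) :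
    ∫ t in Ioi (0 : ℝ), Complex.exp (-q * t) * (r * Complex.exp (t * ℓ)) = r / (q - ℓ) := by
  have h1 : ∀ t : ℝ, Complex.exp (-q * t) * (r * Complex.exp (t * ℓ)) =
      r * Complex.exp (-(q - ℓ) * t) := fun t => by
    rw [mul_left_comm, ← Complex.exp_add]; ring_nf
  simp_rw [h1]
  rw [integral_const_mul, integral_exp_mul_complex_Ioi (by simpa using h)]
  rw [Complex.ofReal_zero, mul_zero, Complex.exp_zero, neg_div_neg_eq, mul_one_div]

/-- The difference between the exact and the approximate resolvent has a second derivative of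
order `ε²`. -/
lemma HasC2Bound.norm_resolvent_deriv_two_le {F F₁ F₂ : ℂ → ℂ} {B : ℝ} (hF : HasC2Bound F F₁ F₂ B)
    {ε : ℝ} (hε : 0 < ε) (hεB : ε * (B + 1) ≤ 1 / 2) {p₀ q : ℂ} (hp₀ : p₀ ∈ closedHalfPlane)
    (hq : 6 * B + 2 ≤ q.re) :
    let r := 1 - ε * F₁ p₀
    let A := q + F (ε * q + p₀)
    let A₀ := q / r + F p₀
    let A₁ := 1 + ε * F₁ (ε * q + p₀)
    let A₂ := (ε : ℂ) ^ 2 * F₂ (ε * q + p₀)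
    A ≠ 0 ∧ A₀ ≠ 0 ∧ ‖(2 * A₁ ^ 2 / A ^ 3 - A₂ / A ^ 2) - 2 * (1 / r) ^ 2 / A₀ ^ 3‖ ≤
      500 * ((2 * B ^ 2 + B) * ε ^ 2) * (‖q‖⁻¹) ^ 2 := by
  intro r A A₀ A₁ A₂
  have hB := hF.nonneg
  have hqn : 6 * B + 2 ≤ ‖q‖ := hq.trans (Complex.re_le_norm q)
  set m := ‖q‖ with hm
  have hm1 : 1 ≤ m := by linarith
  have hp₁ : ε * q + p₀ ∈ closedHalfPlane := by
    have h0 : 0 ≤ p₀.re := hp₀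
    have h1 : 0 ≤ ε * q.re := mul_nonneg hε.le (by linarith)
    simpa [closedHalfPlane] using add_nonneg h1 h0
  have hεn : ‖(ε : ℂ)‖ = ε := by simp [abs_of_pos hε]
  have hεB' : ε * B ≤ 1 / 2 := by nlinarith
  have hεF : ∀ p ∈ closedHalfPlane, ‖(ε : ℂ) * F₁ p‖ ≤ ε * B := fun p hp => by
    rw [norm_mul, hεn]; gcongr; exact hF.bound_one p hp
  have hr1 : ‖1 - r‖ ≤ ε * B := by
    simpa [r] using hεF p₀ hp₀
  have hrlow : 1 / 2 ≤ ‖r‖ := by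
    have := norm_sub_norm_le (1 : ℂ) (1 - r)
    simp only [norm_one, sub_sub_cancel] at this
    linarith
  have hrup : ‖r‖ ≤ 3 / 2 := by
    have := norm_sub_le (1 : ℂ) (1 - r)
    simp only [norm_one, sub_sub_cancel] at this
    linarith
  have hrpos : 0 < ‖r‖ := by linarith
  have hr0 : r ≠ 0 := norm_pos_iff.1 hrpos
  have hR : ‖1 / r‖ ≤ 2 := by
    rw [norm_div, norm_one, div_le_iff₀ hrpos]; linarith
  have hAn : m / 2 ≤ ‖A‖ := by
    have h1 := norm_sub_norm_le q (-F (ε * q + p₀))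
    have h2 := hF.bound _ hp₁
    rw [norm_neg, sub_neg_eq_add] at h1
    change m / 2 ≤ ‖q + F (ε * q + p₀)‖
    linarith
  -- Since ‖r‖ ≤ 3/2, ‖A₀‖ ≥ 2m/3 - B, and m ≥ 6B makes this at least m/2; hence the 6B in the
  -- assumption on q.
  have hA₀n : m / 2 ≤ ‖A₀‖ := by
    have h1 := norm_sub_norm_le (q / r) (-F p₀)
    have h2 := hF.bound _ hp₀
    rw [norm_neg, sub_neg_eq_add, norm_div] at h1
    have h3 : m * (2 / 3) ≤ ‖q‖ / ‖r‖ := by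
      rw [le_div_iff₀ hrpos]; nlinarith
    change m / 2 ≤ ‖q / r + F p₀‖
    linarith
  have hAA1 : ‖A₁‖ ≤ 2 := by
    have := norm_add_le (1 : ℂ) (ε * F₁ (ε * q + p₀))
    have := hεF _ hp₁
    simp only [norm_one] at *
    change ‖1 + ε * F₁ (ε * q + p₀)‖ ≤ 2
    linarith
  -- The first-order Taylor slope is 1 + ε F₁ p₀ = 2 - r, whereas A₀ has slope 1/r. Their difference
  -- is -(1 - r)²/r, so the replacement costs only O(ε²).
  have hquad : ‖(1 - r) ^ 2 / r‖ ≤ 2 * B ^ 2 * ε ^ 2 := by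
    rw [div_eq_mul_one_div, norm_mul, norm_pow]
    calc ‖1 - r‖ ^ 2 * ‖1 / r‖ ≤ (ε * B) ^ 2 * 2 := by gcongr
      _ = _ := by ring
  have hεq : ‖(ε * q + p₀) - p₀‖ = ε * m := by
    rw [add_sub_cancel_right, norm_mul, hεn]
  have hrdef : (ε : ℂ) * F₁ p₀ = 1 - r := by simp [r]
  refine ⟨norm_pos_iff.1 (by linarith), norm_pos_iff.1 (by linarith),
    norm_sub_deriv_two_inv_le (by linarith) hAn hA₀n hAA1 hR ?_ ?_ ?_⟩
  · have e : A - A₀ = -(q * ((1 - r) ^ 2 / r)) +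
        (F (ε * q + p₀) - F p₀ - F₁ p₀ * ((ε * q + p₀) - p₀)) := by
      have : F₁ p₀ * ((ε * q + p₀) - p₀) = q * (1 - r) := by rw [← hrdef]; ring
      rw [this]
      simp only [A, A₀]
      field_simp
      ring
    have t := hF.taylor hp₀ hp₁
    rw [hεq] at t
    rw [e]
    refine (norm_add_le _ _).trans ?_
    rw [norm_neg, norm_mul]
    calc _ ≤ m * (2 * B ^ 2 * ε ^ 2) + B * (ε * m) ^ 2 := by gcongr
      _ ≤ m ^ 2 * (2 * B ^ 2 * ε ^ 2) + B * (ε * m) ^ 2 := by gcongr; nlinarith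
      _ = _ := by ring
  · have e : A₁ - 1 / r = -((1 - r) ^ 2 / r) + ε * (F₁ (ε * q + p₀) - F₁ p₀) := by
      rw [mul_sub, hrdef]
      simp only [A₁]
      field_simp
      ring
    have t := hF.lipschitz hp₀ hp₁
    rw [hεq] at t
    rw [e]
    refine (norm_add_le _ _).trans ?_
    rw [norm_neg, norm_mul, hεn]
    calc _ ≤ 2 * B ^ 2 * ε ^ 2 + ε * (B * (ε * m)) := by gcongr
      _ ≤ 2 * B ^ 2 * ε ^ 2 * m + ε * (B * (ε * m)) := by
          have := le_mul_of_one_le_right (by positivity : 0 ≤ 2 * B ^ 2 * ε ^ 2) hm1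
          linarith
      _ = _ := by ring
  · simp only [A₂]
    rw [norm_mul, norm_pow, hεn]
    calc _ ≤ ε ^ 2 * B := by gcongr; exact hF.bound_two _ hp₁
      _ ≤ _ := by nlinarith [mul_nonneg (sq_nonneg ε) (sq_nonneg B)]

/-- Weak coupling asymptotics of the scalar Volterra equation, uniformly in the energy `E`. -/
theorem scalar_asymptotics {F F₁ F₂ : ℂ → ℂ} {B : ℝ} (hF : HasC2Bound F F₁ F₂ B)
    {ν : Measure ℝ} [IsFiniteMeasure ν] (hν : IsLaplaceTransform (spectralCorrelation ν) F)
    {t : ℝ} (ht : 0 < t) :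
    ∃ C : ℝ, ∀ ε : ℝ, 0 < ε → ε * (B + 1) ≤ 1 / 2 → ∀ (E : ℝ) (x : ℝ → ℂ), Continuous x →
      (∀ s, 0 < s → HasDerivAt x (-(ε * ∫ u in (0 : ℝ)..s,
        spectralCorrelation (ν.map (fun θ => θ - E)) (s - u) * x u)) s) →
      ‖x (ε⁻¹ * t) - x 0 * ((1 - ε * F₁ (-Complex.I * E)) * Complex.exp (t *
        (-F (-Complex.I * E) * (1 - ε * F₁ (-Complex.I * E)))))‖ ≤ C * ε ^ 2 * ‖x 0‖ := by
  have hB := hF.nonneg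
  -- Meets the threshold for q in the resolvent comparison, and c - 1 exceeds the growth rate Re ℓ ≤
  -- 2B.
  set c : ℝ := 6 * B + 2 with hc
  refine ⟨(5000 * (2 * B ^ 2 + B)) * Real.exp (c * t) / t ^ 2, fun ε hε hεB E x hxc hx => ?_⟩
  set p₀ : ℂ := -Complex.I * E with hp₀def
  have hp₀ : p₀ ∈ closedHalfPlane := by simp [closedHalfPlane, p₀]
  set r : ℂ := 1 - ε * F₁ p₀ with hr
  set ℓ : ℂ := -F p₀ * r with hℓ
  have hfin : IsFiniteMeasure (ν.map fun θ => θ - E) := inferInstance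
  have hεn : ‖(ε : ℂ)‖ = ε := by simp [abs_of_pos hε]
  have hrup : ‖r‖ ≤ 3 / 2 := by
    have h1 := norm_sub_le (1 : ℂ) (ε * F₁ p₀)
    have h2 : ‖(ε : ℂ) * F₁ p₀‖ ≤ ε * B := by
      rw [norm_mul, hεn]; gcongr; exact hF.bound_one p₀ hp₀
    rw [norm_one] at h1
    nlinarith
  have hrne : r ≠ 0 := by
    intro h0
    have h2 : ‖(ε : ℂ) * F₁ p₀‖ ≤ ε * B := by
      rw [norm_mul, hεn]; gcongr; exact hF.bound_one p₀ hp₀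
    rw [← sub_eq_zero.1 h0, norm_one] at h2
    nlinarith
  have hℓn : ‖ℓ‖ ≤ 2 * B := by
    rw [hℓ, norm_mul, norm_neg]
    calc ‖F p₀‖ * ‖r‖ ≤ B * (3 / 2) := by gcongr; exact hF.bound _ hp₀
      _ ≤ 2 * B := by linarith
  have hℓre : ℓ.re ≤ 2 * B := (Complex.re_le_norm _).trans hℓn
  have hxb : ∀ s, 0 ≤ s → ‖x s‖ ≤ ‖x 0‖ := fun s hs => norm_le_of_volterra _ hε.le hxc hx hs
  set d : ℝ → ℂ := fun τ => x (ε⁻¹ * τ) - x 0 * (r * Complex.exp (τ * ℓ)) with hd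
  have hdc : Continuous d := by fun_prop
  have hdb : ∀ τ, 0 ≤ τ → ‖d τ‖ ≤ (3 * ‖x 0‖) * Real.exp ((c - 1) * τ) := by
    intro τ hτ
    have h1 := hxb (ε⁻¹ * τ) (by positivity)
    have h2 : ‖Complex.exp (τ * ℓ)‖ ≤ Real.exp ((c - 1) * τ) := by
      rw [Complex.norm_exp, Real.exp_le_exp, Complex.re_ofReal_mul, mul_comm]
      gcongr
      linarith
    have h3 : 1 ≤ Real.exp ((c - 1) * τ) :=
      Real.one_le_exp (mul_nonneg (by linarith) hτ)
    calc ‖d τ‖ ≤ ‖x 0‖ + ‖x 0‖ * (3 / 2 * Real.exp ((c - 1) * τ)) := by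
          refine (norm_sub_le _ _).trans ?_
          rw [norm_mul, norm_mul]
          gcongr
      _ ≤ ‖x 0‖ * Real.exp ((c - 1) * τ) + ‖x 0‖ * (3 / 2 * Real.exp ((c - 1) * τ)) := by
          gcongr; exact le_mul_of_one_le_right (norm_nonneg _) h3
      _ ≤ _ := by nlinarith [mul_nonneg (norm_nonneg (x 0)) (Real.exp_pos ((c - 1) * τ)).le]
  set q : ℝ → ℂ := fun ξ => c + 2 * π * ξ * Complex.I with hqdef
  have hqre : ∀ ξ, (q ξ).re = c := fun ξ => by simp [q]
  have hqd : ∀ ξ, HasDerivAt q (2 * π * Complex.I) ξ := by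
    intro ξ
    have h1 := ((Complex.ofRealCLM.hasDerivAt (x := ξ)).const_mul (2 * π : ℂ)).mul_const Complex.I
    have h2 := h1.const_add (c : ℂ)
    exact h2.congr_deriv (by simp)
  set A : ℝ → ℂ := fun ξ => q ξ + F (ε * q ξ + p₀) with hA
  set A₀ : ℝ → ℂ := fun ξ => q ξ / r + F p₀ with hA₀
  set A₁ : ℝ → ℂ := fun ξ => 1 + ε * F₁ (ε * q ξ + p₀) with hA₁
  set A₂ : ℝ → ℂ := fun ξ => (ε : ℂ) ^ 2 * F₂ (ε * q ξ + p₀) with hA₂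
  have hres := fun ξ => hF.norm_resolvent_deriv_two_le hε hεB hp₀ (q := q ξ) (by rw [hqre])
  have hAne : ∀ ξ, A ξ ≠ 0 := fun ξ => (hres ξ).1
  have hA₀ne : ∀ ξ, A₀ ξ ≠ 0 := fun ξ => (hres ξ).2.1
  have hreq : ∀ ξ, 0 < ((ε : ℂ) * q ξ).re := fun ξ => by
    rw [Complex.re_ofReal_mul, hqre]; positivity
  have hmem : ∀ ξ, 0 < ((ε : ℂ) * q ξ + p₀).re := fun ξ => by
    have : p₀.re = 0 := by simp [p₀]
    rw [Complex.add_re, this, add_zero]; exact hreq ξ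
  have hinner : ∀ ξ, HasDerivAt (fun ξ => (ε : ℂ) * q ξ + p₀) (ε * (2 * π * Complex.I)) ξ :=
    fun ξ => ((hqd ξ).const_mul (ε : ℂ)).add_const p₀
  have hAd : ∀ ξ, HasDerivAt A (2 * π * Complex.I * A₁ ξ) ξ := by
    intro ξ
    have h1 := (hF.deriv_within _ (le_of_lt (hmem ξ))).hasDerivAt (closedHalfPlane_mem_nhds (hmem ξ))
    exact ((hqd ξ).fun_add (h1.comp ξ (hinner ξ))).congr_deriv (by simp only [hA₁]; ring)
  have hA₁d : ∀ ξ, HasDerivAt A₁ (2 * π * Complex.I * A₂ ξ) ξ := by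
    intro ξ
    have h1 := (hF.deriv_within_two _ (le_of_lt (hmem ξ))).hasDerivAt
      (closedHalfPlane_mem_nhds (hmem ξ))
    exact (((h1.comp ξ (hinner ξ)).const_mul (ε : ℂ)).const_add 1).congr_deriv
      (by simp only [hA₂]; ring)
  have hA₀d : ∀ ξ, HasDerivAt A₀ (2 * π * Complex.I * (1 / r)) ξ := fun ξ =>
    (((hqd ξ).div_const r).add_const (F p₀)).congr_deriv (by ring)
  -- The substitution p = εq turns x(0) / (p + ε F(p - iE)) into x(0) / A after rescaling time, and
  -- r / (q - ℓ) = 1 / A₀ because q - ℓ = r A₀.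
  have hlap : ∀ ξ : ℝ, ∫ s in Ioi (0 : ℝ),
      Complex.exp (-(c + 2 * π * ξ * Complex.I) * s) * d s = x 0 * (1 / A ξ - 1 / A₀ ξ) := by
    intro ξ
    have hv := laplace_volterra (ν.map fun θ => θ - E) hε.le hxc hx (hreq ξ)
    rw [hν.eq_integral_map_sub E (hreq ξ)] at hv
    have hpE : (ε : ℂ) * q ξ - Complex.I * E = ε * q ξ + p₀ := by simp only [hp₀def]; ring
    rw [hpE] at hv
    have hscale : ∫ s in Ioi (0 : ℝ), Complex.exp (-q ξ * s) * x (ε⁻¹ * s) =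
        ε * ∫ s in Ioi (0 : ℝ), Complex.exp (-(ε * q ξ) * s) * x s := by
      have h := integral_comp_mul_left_Ioi
        (fun s : ℝ => Complex.exp (-(ε * q ξ) * s) * x s) 0 (inv_pos.2 hε)
      rw [mul_zero, inv_inv, Complex.real_smul] at h
      rw [← h]
      congr 1 with s
      congr 2
      have : (ε : ℂ) ≠ 0 := by exact_mod_cast hε.ne'
      push_cast
      field_simp
    have hx1 : ∫ s in Ioi (0 : ℝ), Complex.exp (-q ξ * s) * x (ε⁻¹ * s) = x 0 / A ξ := by
      rw [hscale, eq_div_iff (hAne ξ), ← hv]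
      simp only [hA]; ring
    have hx2 : ∫ s in Ioi (0 : ℝ), Complex.exp (-q ξ * s) * (x 0 * (r * Complex.exp (s * ℓ))) =
        x 0 / A₀ ξ := by
      have h := integral_exp_mul_exp (q := q ξ) (ℓ := ℓ) (by
        rw [Complex.sub_re, hqre]; linarith) (x 0 * r)
      simp_rw [mul_assoc (x 0) r] at h
      rw [h]
      have : q ξ - ℓ = r * A₀ ξ := by simp only [hℓ, hA₀]; field_simp; ring
      rw [this]
      have := hA₀ne ξ
      field_simp
    have i1 : IntegrableOn (fun s : ℝ => Complex.exp (-q ξ * s) * x (ε⁻¹ * s)) (Ioi 0) :=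
      integrableOn_laplace (by fun_prop) (fun s hs => hxb _ (by positivity))
        (by rw [hqre]; positivity)
    have i2 : IntegrableOn (fun s : ℝ => Complex.exp (-q ξ * s) *
        (x 0 * (r * Complex.exp (s * ℓ)))) (Ioi 0) := by
      have h := (integrableOn_exp_mul_complex_Ioi (a := -(q ξ - ℓ)) (by
        rw [Complex.neg_re, Complex.sub_re, hqre]; linarith) 0).const_mul (x 0 * r)
      refine IntegrableOn.congr_fun h (fun s _ => ?_) measurableSet_Ioi
      have : Complex.exp (-(q ξ - ℓ) * s) = Complex.exp (-q ξ * s) * Complex.exp (s * ℓ) := by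
        rw [← Complex.exp_add]; ring_nf
      simp only [this]; ring
    have hsub := integral_sub i1 i2
    rw [hx1, hx2] at hsub
    calc _ = ∫ s in Ioi (0 : ℝ), (Complex.exp (-q ξ * s) * x (ε⁻¹ * s) -
          Complex.exp (-q ξ * s) * (x 0 * (r * Complex.exp (s * ℓ)))) := by
          congr 1 with s; simp only [hd, hqdef]; ring
      _ = _ := by rw [hsub]; ring
  have hDd : ∀ ξ, HasDerivAt (fun ξ => x 0 * (1 / A ξ - 1 / A₀ ξ))
      (x 0 * (2 * π * Complex.I) * ((1 / r) / A₀ ξ ^ 2 - A₁ ξ / A ξ ^ 2)) ξ := by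
    intro ξ
    have h1 := (hAd ξ).fun_inv (hAne ξ)
    have h2 := (hA₀d ξ).fun_inv (hA₀ne ξ)
    simp_rw [one_div]
    exact ((h1.fun_sub h2).const_mul (x 0)).congr_deriv (by rw [one_div]; ring)
  have hD₁d : ∀ ξ, HasDerivAt
      (fun ξ => x 0 * (2 * π * Complex.I) * ((1 / r) / A₀ ξ ^ 2 - A₁ ξ / A ξ ^ 2))
      (x 0 * (2 * π * Complex.I) ^ 2 * ((2 * A₁ ξ ^ 2 / A ξ ^ 3 - A₂ ξ / A ξ ^ 2) -
        2 * (1 / r) ^ 2 / A₀ ξ ^ 3)) ξ := by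
    intro ξ
    have h1 := (hA₁d ξ).fun_div ((hAd ξ).fun_pow 2) (pow_ne_zero 2 (hAne ξ))
    have h2 := (hasDerivAt_const ξ (1 / r)).fun_div ((hA₀d ξ).fun_pow 2) (pow_ne_zero 2 (hA₀ne ξ))
    refine ((h2.fun_sub h1).const_mul _).congr_deriv ?_
    have := hAne ξ
    have := hA₀ne ξ
    field_simp
    ring
  -- The constant is 40 · 500 / 4: (2π)² ≤ 40, and c ≥ 2 gives ‖q‖² ≥ 4(1 + ξ²).
  have hbound : ∀ ξ, ‖x 0 * (2 * π * Complex.I) ^ 2 * ((2 * A₁ ξ ^ 2 / A ξ ^ 3 - A₂ ξ / A ξ ^ 2) -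
        2 * (1 / r) ^ 2 / A₀ ξ ^ 3)‖ ≤
      (5000 * (2 * B ^ 2 + B) * ε ^ 2 * ‖x 0‖) * (1 + ξ ^ 2)⁻¹ := by
    intro ξ
    have hpi := Real.pi_gt_three
    have hpi4 := Real.pi_le_four
    have hqsq : 4 * (1 + ξ ^ 2) ≤ ‖q ξ‖ ^ 2 := by
      have : ‖q ξ‖ ^ 2 = c ^ 2 + (2 * π * ξ) ^ 2 := by
        rw [Complex.sq_norm, Complex.normSq_apply, hqre]
        simp [q]; ring
      rw [this]
      have h1 : 4 ≤ c ^ 2 := by nlinarith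
      have h2 : 1 ≤ π ^ 2 := by nlinarith
      nlinarith [mul_le_mul_of_nonneg_right h2 (sq_nonneg ξ)]
    have hqinv : (‖q ξ‖⁻¹) ^ 2 ≤ 4⁻¹ * (1 + ξ ^ 2)⁻¹ := by
      rw [inv_pow, ← mul_inv]
      gcongr
    have h2pi : ‖(2 * π * Complex.I : ℂ) ^ 2‖ ≤ 40 := by
      rw [norm_pow, norm_mul, norm_mul, Complex.norm_I, Complex.norm_real, Complex.norm_ofNat,
        Real.norm_of_nonneg Real.pi_pos.le]
      have := Real.pi_lt_d2
      nlinarith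
    rw [norm_mul, norm_mul]
    calc _ ≤ ‖x 0‖ * 40 * (500 * ((2 * B ^ 2 + B) * ε ^ 2) * (4⁻¹ * (1 + ξ ^ 2)⁻¹)) := by
          gcongr
          exact (hres ξ).2.2.trans (by gcongr)
      _ = _ := by ring
  have hfinal := norm_le_of_laplace_deriv_two hdc hdb hlap hDd hD₁d hbound ht
  have : ‖d t‖ ≤ (5000 * (2 * B ^ 2 + B) * ε ^ 2 * ‖x 0‖) * Real.exp (c * t) / t ^ 2 := by
    rw [le_div_iff₀ (by positivity)]; linarith
  refine this.trans (le_of_eq ?_)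
  ring

end

/-! ### Perturbation of functions of a Hermitian matrix. -/

section

/-! ### Divided differences -/

/-- The integral form includes the confluent case x = b, so estimates on divided differences need no
case distinction. -/
lemma dslope_eq_integral {f f' : ℝ → ℂ} (hf : ∀ x, HasDerivAt f (f' x) x) (hc : Continuous f')
    (b x : ℝ) : dslope f b x = ∫ s in (0 : ℝ)..1, f' (b + s * (x - b)) := by
  rcases eq_or_ne x b with rfl | hx
  · simp [dslope_same, (hf x).deriv]
  · rw [dslope_of_ne _ hx, slope_def_module]
    have hne : x - b ≠ 0 := sub_ne_zero.2 hx
    have h : ∀ s : ℝ, HasDerivAt (fun s : ℝ => f (b + s * (x - b)))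
        ((x - b) • f' (b + s * (x - b))) s := fun s => by
      have h1 : HasDerivAt (fun s : ℝ => b + s * (x - b)) (x - b) s := by
        have := ((hasDerivAt_id s).mul_const (x - b)).const_add b
        rwa [one_mul] at this
      exact (hf _).scomp s h1
    have hI := intervalIntegral.integral_eq_sub_of_hasDerivAt (a := 0) (b := 1) (fun s _ => h s)
      (by apply Continuous.intervalIntegrable; fun_prop)
    rw [intervalIntegral.integral_smul] at hI
    rw [inv_smul_eq_iff₀ hne, hI]
    simp

/-- Divided differences of a function with Lipschitz derivative are Lipschitz. -/
lemma norm_dslope_sub_le {f f' : ℝ → ℂ} (hf : ∀ x, HasDerivAt f (f' x) x) {K : ℝ}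
    (hK : ∀ x y, ‖f' x - f' y‖ ≤ K * |x - y|) (b x y : ℝ) :
    ‖dslope f b x - dslope f b y‖ ≤ K * |x - y| := by
  have hK0 : 0 ≤ K := by simpa using (norm_nonneg _).trans (hK 1 0)
  have hc : Continuous f' := (LipschitzWith.of_dist_le_mul (K := ⟨K, hK0⟩) fun x y => by
    rw [dist_eq_norm, Real.dist_eq]; exact hK x y).continuous
  rw [dslope_eq_integral hf hc, dslope_eq_integral hf hc, ← intervalIntegral.integral_sub
    (by apply Continuous.intervalIntegrable; fun_prop)
    (by apply Continuous.intervalIntegrable; fun_prop)]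
  have := intervalIntegral.norm_integral_le_of_norm_le_const (a := 0) (b := 1)
    (C := K * |x - y|) (f := fun s => f' (b + s * (x - b)) - f' (b + s * (y - b))) (fun s hs => by
      rw [uIoc_of_le zero_le_one] at hs
      refine (hK _ _).trans ?_
      have e : b + s * (x - b) - (b + s * (y - b)) = s * (x - y) := by ring
      rw [e, abs_mul, abs_of_pos hs.1]
      gcongr
      exact mul_le_of_le_one_left (abs_nonneg _) hs.2)
  simpa using this

/-! ### Functions of a Hermitian matrix -/

variable {N : ℕ}

lemma star_eigenvectorUnitary_mul {A : Mat N} (hA : A.IsHermitian) :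
    star (hA.eigenvectorUnitary : Mat N) * (hA.eigenvectorUnitary : Mat N) = 1 :=
  Unitary.coe_star_mul_self _

lemma eigenvectorUnitary_mul_star {A : Mat N} (hA : A.IsHermitian) :
    (hA.eigenvectorUnitary : Mat N) * star (hA.eigenvectorUnitary : Mat N) = 1 :=
  Unitary.coe_mul_star_self _

/-- The matrix of `B` with respect to eigenbases of two Hermitian matrices. -/
noncomputable def inEigenbases {A' A : Mat N} (hA' : A'.IsHermitian) (hA : A.IsHermitian)
    (B : Mat N) : Mat N :=
  star (hA'.eigenvectorUnitary : Mat N) * B * (hA.eigenvectorUnitary : Mat N)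

lemma eq_mul_inEigenbases_mul {A' A : Mat N} (hA' : A'.IsHermitian) (hA : A.IsHermitian)
    (B : Mat N) : B = (hA'.eigenvectorUnitary : Mat N) * inEigenbases hA' hA B *
      star (hA.eigenvectorUnitary : Mat N) := by
  simp only [inEigenbases, mul_assoc, eigenvectorUnitary_mul_star, mul_one]
  rw [← mul_assoc, eigenvectorUnitary_mul_star, one_mul]

lemma inEigenbases_mul {A'' A' A : Mat N} (hA'' : A''.IsHermitian) (hA' : A'.IsHermitian)
    (hA : A.IsHermitian) (B C : Mat N) :
    inEigenbases hA'' hA (B * C) = inEigenbases hA'' hA' B * inEigenbases hA' hA C := by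
  simp only [inEigenbases, mul_assoc]
  rw [← mul_assoc (hA'.eigenvectorUnitary : Mat N) (star _), eigenvectorUnitary_mul_star, one_mul]

lemma inEigenbases_sub {A' A : Mat N} (hA' : A'.IsHermitian) (hA : A.IsHermitian) (B C : Mat N) :
    inEigenbases hA' hA (B - C) = inEigenbases hA' hA B - inEigenbases hA' hA C := by
  simp [inEigenbases, mul_sub, sub_mul]

lemma inEigenbases_smul {A' A : Mat N} (hA' : A'.IsHermitian) (hA : A.IsHermitian) (c : ℂ)
    (B : Mat N) : inEigenbases hA' hA (c • B) = c • inEigenbases hA' hA B := by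
  simp [inEigenbases]

lemma inEigenbases_self_one {A : Mat N} (hA : A.IsHermitian) : inEigenbases hA hA 1 = 1 := by
  simp [inEigenbases]

lemma inEigenbases_matFun {A : Mat N} (hA : A.IsHermitian) (f : ℝ → ℂ) :
    inEigenbases hA hA (matFun hA f) = Matrix.diagonal fun α => f (hA.eigenvalues α) := by
  simp only [inEigenbases, matFun, mul_assoc, star_eigenvectorUnitary_mul, mul_one]
  rw [← mul_assoc, star_eigenvectorUnitary_mul, one_mul]

lemma inEigenbases_injective {A' A : Mat N} (hA' : A'.IsHermitian) (hA : A.IsHermitian) :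
    Function.Injective (inEigenbases hA' hA) := fun B C h => by
  rw [eq_mul_inEigenbases_mul hA' hA B, eq_mul_inEigenbases_mul hA' hA C, h]

/-- A matrix multiplied from both sides by unitary matrices has entries of the same size. -/
lemma norm_unitary_mul_mul_le {U V : Mat N} (hU : ∀ i j, ‖U i j‖ ≤ 1) (hV : ∀ i j, ‖V i j‖ ≤ 1)
    {B : Mat N} {C : ℝ} (hB : ∀ i j, ‖B i j‖ ≤ C) (i j : Fin N) :
    ‖(U * B * V) i j‖ ≤ N ^ 2 * C := by
  rw [Matrix.mul_apply]
  calc ‖∑ k, (U * B) i k * V k j‖ ≤ ∑ _k : Fin N, (N * C) := by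
        refine norm_sum_le_of_le _ fun k _ => ?_
        rw [Matrix.mul_apply, norm_mul]
        have h1 : ‖∑ l, U i l * B l k‖ ≤ ∑ _l : Fin N, C := norm_sum_le_of_le _ fun l _ => by
          rw [norm_mul]
          exact (mul_le_of_le_one_left (norm_nonneg _) (hU i l)).trans (hB l k)
        rw [Finset.sum_const, Finset.card_univ, Fintype.card_fin, nsmul_eq_mul] at h1
        exact (mul_le_of_le_one_right (norm_nonneg _) (hV k j)).trans h1
    _ = _ := by
        rw [Finset.sum_const, Finset.card_univ, Fintype.card_fin, nsmul_eq_mul]; ring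

lemma norm_eigenvectorUnitary_le {A : Mat N} (hA : A.IsHermitian) (i j : Fin N) :
    ‖(hA.eigenvectorUnitary : Mat N) i j‖ ≤ 1 :=
  entry_norm_bound_of_unitary hA.eigenvectorUnitary.2 i j

lemma norm_star_eigenvectorUnitary_le {A : Mat N} (hA : A.IsHermitian) (i j : Fin N) :
    ‖star (hA.eigenvectorUnitary : Mat N) i j‖ ≤ 1 := by
  rw [Matrix.star_apply, norm_star]; exact norm_eigenvectorUnitary_le hA j i

lemma norm_inEigenbases_le {A' A : Mat N} (hA' : A'.IsHermitian) (hA : A.IsHermitian) {B : Mat N}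
    {C : ℝ} (hB : ∀ i j, ‖B i j‖ ≤ C) (i j : Fin N) : ‖inEigenbases hA' hA B i j‖ ≤ N ^ 2 * C :=
  norm_unitary_mul_mul_le (norm_star_eigenvectorUnitary_le hA') (norm_eigenvectorUnitary_le hA)
    hB i j

lemma norm_le_of_inEigenbases {A' A : Mat N} (hA' : A'.IsHermitian) (hA : A.IsHermitian)
    {B : Mat N} {C : ℝ} (hB : ∀ i j, ‖inEigenbases hA' hA B i j‖ ≤ C) (i j : Fin N) :
    ‖B i j‖ ≤ N ^ 2 * C := by
  rw [eq_mul_inEigenbases_mul hA' hA B]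
  exact norm_unitary_mul_mul_le (norm_eigenvectorUnitary_le hA')
    (norm_star_eigenvectorUnitary_le hA) hB i j

lemma matFun_mul {A : Mat N} (hA : A.IsHermitian) (f g : ℝ → ℂ) :
    matFun hA (fun E => f E * g E) = matFun hA f * matFun hA g := by
  apply inEigenbases_injective hA hA
  simp [inEigenbases_mul hA hA hA, inEigenbases_matFun]

lemma matFun_sub {A : Mat N} (hA : A.IsHermitian) (f g : ℝ → ℂ) :
    matFun hA (fun E => f E - g E) = matFun hA f - matFun hA g := by
  apply inEigenbases_injective hA hA
  simp [inEigenbases_sub, inEigenbases_matFun]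

lemma matFun_const_mul {A : Mat N} (hA : A.IsHermitian) (c : ℂ) (f : ℝ → ℂ) :
    matFun hA (fun E => c * f E) = c • matFun hA f := by
  apply inEigenbases_injective hA hA
  rw [inEigenbases_smul, inEigenbases_matFun, inEigenbases_matFun, ← Matrix.diagonal_smul]
  rfl

lemma matFun_one {A : Mat N} (hA : A.IsHermitian) : matFun hA (fun _ => 1) = 1 := by
  apply inEigenbases_injective hA hA
  rw [inEigenbases_matFun, inEigenbases_self_one, Matrix.diagonal_one]

lemma matFun_id {A : Mat N} (hA : A.IsHermitian) : matFun hA (fun E => (E : ℂ)) = A :=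
  hA.spectral_theorem.symm

lemma matFun_exp {A : Mat N} (hA : A.IsHermitian) (f : ℝ → ℂ) :
    matFun hA (fun E => Complex.exp (f E)) = NormedSpace.exp (matFun hA f) := by
  have hinv : (hA.eigenvectorUnitary : Mat N)⁻¹ = star (hA.eigenvectorUnitary : Mat N) :=
    Matrix.inv_eq_right_inv (eigenvectorUnitary_mul_star hA)
  have hunit : IsUnit (hA.eigenvectorUnitary : Mat N) :=
    ⟨⟨_, _, eigenvectorUnitary_mul_star hA, star_eigenvectorUnitary_mul hA⟩, rfl⟩
  rw [matFun, matFun, ← hinv, Matrix.exp_conj _ _ hunit, Matrix.exp_diagonal]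
  congr 3
  ext α
  rw [Pi.coe_exp, Complex.exp_eq_exp_ℂ]

/-- Using the eigenbasis of A' on the left and that of A on the right makes the difference an
entrywise multiple of the overlap matrix. No continuity of eigenvectors is needed, even at
degenerate eigenvalues. -/
lemma inEigenbases_sub_apply {A' A : Mat N} (hA' : A'.IsHermitian) (hA : A.IsHermitian)
    (f : ℝ → ℂ) (i j : Fin N) : inEigenbases hA' hA (matFun hA' f - matFun hA f) i j =
      (f (hA'.eigenvalues i) - f (hA.eigenvalues j)) * inEigenbases hA' hA 1 i j := by
  rw [inEigenbases_sub]
  nth_rw 1 [← mul_one (matFun hA' f)]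
  nth_rw 1 [← one_mul (matFun hA f)]
  rw [inEigenbases_mul hA' hA' hA, inEigenbases_mul hA' hA hA, inEigenbases_matFun,
    inEigenbases_matFun, Matrix.sub_apply, Matrix.diagonal_mul, Matrix.mul_diagonal]
  ring

lemma inEigenbases_sub_self_apply {A' A : Mat N} (hA' : A'.IsHermitian) (hA : A.IsHermitian)
    (i j : Fin N) : inEigenbases hA' hA (A' - A) i j =
      ((hA'.eigenvalues i : ℂ) - hA.eigenvalues j) * inEigenbases hA' hA 1 i j := by
  have := inEigenbases_sub_apply hA' hA (fun E => (E : ℂ)) i j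
  rwa [matFun_id, matFun_id] at this

/-- Lipschitz functions of Hermitian matrices are Lipschitz. -/
lemma norm_matFun_sub_le {A' A : Mat N} (hA' : A'.IsHermitian) (hA : A.IsHermitian) {f : ℝ → ℂ}
    {K C : ℝ} (hK : ∀ x y, ‖f x - f y‖ ≤ K * |x - y|) (hC : ∀ i j, ‖(A' - A) i j‖ ≤ C)
    (i j : Fin N) : ‖(matFun hA' f - matFun hA f) i j‖ ≤ N ^ 2 * (K * (N ^ 2 * C)) := by
  have hK0 : 0 ≤ K := by simpa using (norm_nonneg _).trans (hK 1 0)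
  refine norm_le_of_inEigenbases hA' hA (fun i j => ?_) i j
  rw [inEigenbases_sub_apply, norm_mul]
  -- The eigenvalue gap times the overlap is an entry of A' - A, so the Lipschitz bound on f turns
  -- into a bound by C.
  have h := norm_inEigenbases_le hA' hA hC i j
  rw [inEigenbases_sub_self_apply, norm_mul, ← Complex.ofReal_sub, Complex.norm_real,
    Real.norm_eq_abs] at h
  calc _ ≤ K * |hA'.eigenvalues i - hA.eigenvalues j| * ‖inEigenbases hA' hA 1 i j‖ := by
        gcongr; exact hK _ _
    _ ≤ _ := by rw [mul_assoc]; gcongr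

/-- The first variation of `f(A)` in the direction `B` (Daletskii-Krein formula). -/
noncomputable def firstVariation {A : Mat N} (hA : A.IsHermitian) (f : ℝ → ℂ) (B : Mat N) :
    Mat N :=
  (hA.eigenvectorUnitary : Mat N) * Matrix.of (fun k j =>
    dslope f (hA.eigenvalues j) (hA.eigenvalues k) * inEigenbases hA hA B k j) *
    star (hA.eigenvectorUnitary : Mat N)

lemma inEigenbases_firstVariation {A : Mat N} (hA : A.IsHermitian) (f : ℝ → ℂ) (B : Mat N) :
    inEigenbases hA hA (firstVariation hA f B) = Matrix.of (fun k j =>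
      dslope f (hA.eigenvalues j) (hA.eigenvalues k) * inEigenbases hA hA B k j) := by
  simp only [inEigenbases, firstVariation, mul_assoc, star_eigenvectorUnitary_mul, mul_one]
  rw [← mul_assoc, star_eigenvectorUnitary_mul, one_mul]

/-- First order expansion of a function of a Hermitian matrix, with a quadratic remainder. -/
lemma norm_matFun_sub_firstVariation_le {A' A : Mat N} (hA' : A'.IsHermitian) (hA : A.IsHermitian)
    {f f' : ℝ → ℂ} (hf : ∀ x, HasDerivAt f (f' x) x) {K C : ℝ}
    (hK : ∀ x y, ‖f' x - f' y‖ ≤ K * |x - y|) (hC : ∀ i j, ‖(A' - A) i j‖ ≤ C) (i j : Fin N) :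
    ‖(matFun hA' f - matFun hA f - firstVariation hA f (A' - A)) i j‖ ≤
      N ^ 2 * (N * (K * (N ^ 2 * C) * (N ^ 2 * C))) := by
  have hK0 : 0 ≤ K := by simpa using (norm_nonneg _).trans (hK 1 0)
  refine norm_le_of_inEigenbases hA' hA (fun i j => ?_) i j
  set a' := hA'.eigenvalues
  set a := hA.eigenvalues
  set S := inEigenbases hA' hA 1
  set Z := inEigenbases hA hA (A' - A)
  have hX : inEigenbases hA' hA (A' - A) = S * Z := by
    rw [← inEigenbases_mul, one_mul]
  have h1 : inEigenbases hA' hA (matFun hA' f - matFun hA f) i j =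
      ∑ k, dslope f (a j) (a' i) * (S i k * Z k j) := by
    rw [← Finset.mul_sum, ← Matrix.mul_apply, ← hX, inEigenbases_sub_apply,
      inEigenbases_sub_self_apply, ← mul_assoc]
    congr 1
    have := sub_smul_dslope f (a j) (a' i)
    rw [← this, Complex.real_smul]
    push_cast; ring
  have h2 : inEigenbases hA' hA (firstVariation hA f (A' - A)) i j =
      ∑ k, S i k * (dslope f (a j) (a k) * Z k j) := by
    have e := inEigenbases_mul hA' hA hA 1 (firstVariation hA f (A' - A))
    rw [one_mul, inEigenbases_firstVariation] at e
    rw [e, Matrix.mul_apply]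
    rfl
  rw [inEigenbases_sub, Matrix.sub_apply, h1, h2, ← Finset.sum_sub_distrib]
  calc _ ≤ ∑ _k : Fin N, (K * (N ^ 2 * C) * (N ^ 2 * C)) := by
        refine norm_sum_le_of_le _ fun k _ => ?_
        -- The Lipschitz bound on the divided difference yields the gap a' i - a k, which with S i k
        -- is again an entry of A' - A; Z k j is a second such factor, so the remainder is
        -- quadratic.
        have e : dslope f (a j) (a' i) * (S i k * Z k j) - S i k * (dslope f (a j) (a k) * Z k j) =
          (dslope f (a j) (a' i) - dslope f (a j) (a k)) * S i k * Z k j := by ring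
        have h := norm_inEigenbases_le hA' hA hC i k
        rw [inEigenbases_sub_self_apply, norm_mul, ← Complex.ofReal_sub, Complex.norm_real,
          Real.norm_eq_abs] at h
        have hZ := norm_inEigenbases_le hA hA hC k j
        rw [e, norm_mul, norm_mul]
        have hC0 : 0 ≤ N ^ 2 * C := (norm_nonneg _).trans hZ
        refine mul_le_mul ?_ hZ (norm_nonneg _) (mul_nonneg hK0 hC0)
        calc _ ≤ K * |a' i - a k| * ‖S i k‖ := by
              gcongr; exact norm_dslope_sub_le hf hK _ _ _
          _ ≤ _ := by rw [mul_assoc]; gcongr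
    _ = _ := by rw [Finset.sum_const, Finset.card_univ, Fintype.card_fin, nsmul_eq_mul]

end

section

variable {N : ℕ}

/-! ### The propagator in the eigenbasis of the Hamiltonian -/

lemma exp_smul_eq_matFun {H : Mat N} (hH : H.IsHermitian) (c : ℂ) :
    NormedSpace.exp (c • H) = matFun hH (fun E => Complex.exp (c * E)) := by
  rw [matFun_exp hH, matFun_const_mul hH, matFun_id]

lemma inEigenbases_apply {A' A : Mat N} (hA' : A'.IsHermitian) (hA : A.IsHermitian) (B : Mat N)
    (α β : Fin N) : inEigenbases hA' hA B α β = ∑ j, ∑ i,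
      star (hA'.eigenvectorUnitary : Mat N) α i * (hA.eigenvectorUnitary : Mat N) j β * B i j := by
  rw [inEigenbases, Matrix.mul_apply]
  refine Finset.sum_congr rfl fun j _ => ?_
  rw [Matrix.mul_apply, Finset.sum_mul]
  exact Finset.sum_congr rfl fun i _ => by ring

/-- The matrix elements of the propagator in an eigenbasis of the Hamiltonian solve scalar
Volterra equations. -/
lemma IsPropagator.inEigenbases_volterra {ν : Measure ℝ} [IsFiniteMeasure ν] {ε : ℝ} {H : Mat N}
    (hH : H.IsHermitian) {V : ℝ → Mat N}
    (hV : IsPropagator (fun t => (ε : ℂ) * spectralCorrelation ν t) H V) (α β : Fin N) :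
    Continuous (fun t => inEigenbases hH hH (V (max t 0)) α β) ∧
    ∀ t, 0 < t → HasDerivAt (fun t => inEigenbases hH hH (V (max t 0)) α β)
      (-(ε * ∫ u in (0 : ℝ)..t,
        spectralCorrelation (ν.map (fun θ => θ - hH.eigenvalues α)) (t - u) *
          inEigenbases hH hH (V (max u 0)) α β)) t := by
  -- Since V is unconstrained for negative times, `max t 0` extends it by its initial value and
  -- gives a globally continuous function.
  have hVc : ∀ i j, Continuous fun t => V (max t 0) i j := by
    intro i j
    have h1 : ContinuousOn (fun t => V t i j) (Ici 0) := fun t ht =>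
      (hV.2 t ht i j).continuousWithinAt
    exact h1.comp_continuous (by fun_prop) fun t => le_max_right t 0
  have hVm : Continuous fun t => V (max t 0) := continuous_matrix hVc
  refine ⟨?_, fun t ht => ?_⟩
  · exact ((continuous_const.matrix_mul hVm).matrix_mul continuous_const).matrix_elem α β
  set Φ : ℝ → Mat N := fun s => ((ε : ℂ) * spectralCorrelation ν (t - s)) •
    (NormedSpace.exp ((Complex.I * ((t - s : ℝ) : ℂ)) • H) * V (max s 0)) with hΦ
  have hk := continuous_spectralCorrelation ν
  have hΦc : Continuous Φ := by
    simp only [hΦ, exp_smul_eq_matFun hH, matFun]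
    have hd : Continuous fun s : ℝ => Matrix.diagonal fun α =>
        Complex.exp (Complex.I * ((t - s : ℝ) : ℂ) * hH.eigenvalues α) :=
      Continuous.matrix_diagonal (by fun_prop)
    exact ((by fun_prop : Continuous fun s => (ε : ℂ) * spectralCorrelation ν (t - s)).smul
      (((continuous_const.matrix_mul hd).matrix_mul continuous_const).matrix_mul hVm))
  have hΦij : ∀ i j, Continuous fun s => Φ s i j := fun i j => hΦc.matrix_elem i j
  have hderiv : ∀ i j, HasDerivAt (fun t => V (max t 0) i j) (-∫ s in (0 : ℝ)..t, Φ s i j) t := by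
    intro i j
    have h1 := (hV.2 t ht.le i j).hasDerivAt (Ici_mem_nhds ht)
    have h2 : (∫ s in (0 : ℝ)..t, (((ε : ℂ) * spectralCorrelation ν (t - s)) •
        (NormedSpace.exp ((Complex.I * ((t - s : ℝ) : ℂ)) • H) * V s)) i j) =
        ∫ s in (0 : ℝ)..t, Φ s i j := by
      refine intervalIntegral.integral_congr fun s hs => ?_
      rw [uIcc_of_le ht.le] at hs
      simp only [hΦ, max_eq_left hs.1]
    simp only at h1
    rw [h2] at h1
    refine h1.congr_of_eventuallyEq ?_
    filter_upwards [Ioi_mem_nhds ht] with s hs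
    rw [max_eq_left (le_of_lt hs)]
  -- The exponential is diagonal in this basis; its phase on row α shifts the spectral measure by
  -- the α-th eigenvalue, and the rows decouple.
  have hΦE : ∀ s, inEigenbases hH hH (Φ s) α β =
      ε * (spectralCorrelation (ν.map (fun θ => θ - hH.eigenvalues α)) (t - s) *
        inEigenbases hH hH (V (max s 0)) α β) := by
    intro s
    simp only [hΦ]
    rw [inEigenbases_smul, inEigenbases_mul hH hH hH, exp_smul_eq_matFun hH,
      inEigenbases_matFun, Matrix.smul_apply, Matrix.diagonal_mul, spectralCorrelation_map_sub,
      smul_eq_mul]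
    have : Complex.I * ((t - s : ℝ) : ℂ) * hH.eigenvalues α =
      Complex.I * hH.eigenvalues α * ((t - s : ℝ) : ℂ) := by ring
    rw [this]
    ring
  have hsum : HasDerivAt (fun t => inEigenbases hH hH (V (max t 0)) α β)
      (∑ j, ∑ i, star (hH.eigenvectorUnitary : Mat N) α i * (hH.eigenvectorUnitary : Mat N) j β *
        -∫ s in (0 : ℝ)..t, Φ s i j) t := by
    simp_rw [inEigenbases_apply]
    exact HasDerivAt.fun_sum fun j _ => HasDerivAt.fun_sum fun i _ => (hderiv i j).const_mul _
  refine hsum.congr_deriv ?_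
  rw [← intervalIntegral.integral_const_mul]
  simp_rw [← hΦE, inEigenbases_apply]
  rw [intervalIntegral.integral_finsetSum fun j _ =>
    (continuous_finsetSum _ fun i _ => (hΦij i j).const_mul _).intervalIntegrable _ _,
    ← Finset.sum_neg_distrib]
  refine Finset.sum_congr rfl fun j _ => ?_
  rw [intervalIntegral.integral_finsetSum fun i _ =>
    ((hΦij i j).const_mul _).intervalIntegrable _ _, ← Finset.sum_neg_distrib]
  refine Finset.sum_congr rfl fun i _ => ?_
  rw [intervalIntegral.integral_const_mul]
  ring

/-! ### The Feynman-ordered first order term -/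

lemma inEigenbases_sum {ι : Type*} {A' A : Mat N} (hA' : A'.IsHermitian) (hA : A.IsHermitian)
    (s : Finset ι) (B : ι → Mat N) :
    inEigenbases hA' hA (∑ l ∈ s, B l) = ∑ l ∈ s, inEigenbases hA' hA (B l) := by
  simp [inEigenbases, Finset.mul_sum, Finset.sum_mul]

lemma eigenvalues_mem_eigenvalueSet {A : Mat N} (hA : A.IsHermitian) (i : Fin N) :
    hA.eigenvalues i ∈ eigenvalueSet hA :=
  Finset.mem_image_of_mem _ (Finset.mem_univ i)

lemma sum_smul_specProj {A : Mat N} (hA : A.IsHermitian) :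
    ∑ a ∈ eigenvalueSet hA, (a : ℂ) • specProj hA a = A := by
  apply inEigenbases_injective hA hA
  rw [inEigenbases_sum]
  have h := inEigenbases_matFun hA fun E => (E : ℂ)
  rw [matFun_id] at h
  rw [h]
  ext i j
  simp only [inEigenbases_smul, specProj, inEigenbases_matFun, Matrix.sum_apply,
    Matrix.smul_apply, Matrix.diagonal_apply, smul_eq_mul]
  split_ifs
  · simp [eigenvalues_mem_eigenvalueSet]
  · simp

/-- The outer projectors select one eigenvalue for the row and one for the column, while the sum
over the spectrum of H₂ reassembles H₂ by `sum_smul_specProj`. -/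
lemma inEigenbases_orderedDiff {H₀ H₂ : Mat N} (h₀ : H₀.IsHermitian) (h₂ : H₂.IsHermitian)
    (F : ℂ → ℂ) (k j : Fin N) :
    inEigenbases h₀ h₀ (orderedDiff h₀ h₂ F) k j =
      diffDeriv F (-Complex.I * h₀.eigenvalues j) (-Complex.I * h₀.eigenvalues k) *
        inEigenbases h₀ h₀ H₂ k j := by
  have key : ∀ a₁ a₂ a₃ : ℝ, inEigenbases h₀ h₀ (specProj h₀ a₃ * specProj h₂ a₁ * specProj h₀ a₂)
      k j = (if h₀.eigenvalues k = a₃ then 1 else 0) * inEigenbases h₀ h₀ (specProj h₂ a₁) k j *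
        (if h₀.eigenvalues j = a₂ then 1 else 0) := by
    intro a₁ a₂ a₃
    rw [inEigenbases_mul h₀ h₀ h₀, inEigenbases_mul h₀ h₀ h₀]
    nth_rw 3 [specProj]
    nth_rw 1 [specProj]
    rw [inEigenbases_matFun, inEigenbases_matFun, Matrix.mul_diagonal, Matrix.diagonal_mul]
  have hH₂ : inEigenbases h₀ h₀ H₂ k j =
      ∑ a ∈ eigenvalueSet h₂, (a : ℂ) * inEigenbases h₀ h₀ (specProj h₂ a) k j := by
    nth_rw 1 [← sum_smul_specProj h₂]
    simp only [inEigenbases_sum, inEigenbases_smul, Matrix.sum_apply, Matrix.smul_apply, smul_eq_mul]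
  rw [orderedDiff, feynman213, hH₂, Finset.mul_sum]
  simp only [inEigenbases_sum, inEigenbases_smul, Matrix.sum_apply, Matrix.smul_apply, key,
    smul_eq_mul]
  refine Finset.sum_congr rfl fun a _ => ?_
  rw [Finset.sum_eq_single_of_mem _ (eigenvalues_mem_eigenvalueSet h₀ j) fun b _ hb => by
    simp [hb.symm],
    Finset.sum_eq_single_of_mem _ (eigenvalues_mem_eigenvalueSet h₀ k) fun b _ hb => by
    simp [hb.symm]]
  simp only [if_true]
  ring

/-- The imaginary axis lies inside the closed half-plane, so a derivative within the half-plane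
restricts to a two-sided derivative along the axis. -/
lemma IsBoundedC2.hasDerivAt_comp_neg_I {F : ℂ → ℂ} (hF : IsBoundedC2 F) (E : ℝ) :
    HasDerivAt (fun E : ℝ => F (-Complex.I * E))
      (-Complex.I * hpDeriv F (-Complex.I * E)) E := by
  have hmem : ∀ E : ℝ, -Complex.I * (E : ℂ) ∈ closedHalfPlane := fun E => by
    simp [closedHalfPlane]
  have h1 : HasDerivAt (fun E : ℝ => -Complex.I * (E : ℂ)) (-Complex.I) E := by
    have := (Complex.ofRealCLM.hasDerivAt (x := E)).const_mul (-Complex.I)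
    exact this.congr_deriv (by simp)
  have h2 := (hF.hasDerivWithinAt (hmem E)).scomp E (g₁ := F) (h := fun E : ℝ => -Complex.I * (E : ℂ))
    h1.hasDerivWithinAt (s := univ) (fun E _ => hmem E)
  rw [hasDerivWithinAt_univ] at h2
  exact h2.congr_deriv (by rw [smul_eq_mul])

lemma dslope_comp_neg_I {F : ℂ → ℂ} (hF : IsBoundedC2 F) (x y : ℝ) :
    dslope (fun E : ℝ => F (-Complex.I * E)) x y =
      -Complex.I * diffDeriv F (-Complex.I * x) (-Complex.I * y) := by
  rcases eq_or_ne y x with rfl | h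
  · rw [dslope_same, (hF.hasDerivAt_comp_neg_I y).deriv, diffDeriv, if_pos rfl]
  · have hc : (y : ℂ) - x ≠ 0 := by
      rw [sub_ne_zero]; exact_mod_cast h
    have hne : -Complex.I * (x : ℂ) ≠ -Complex.I * y := fun h' => h.symm (by
      have := mul_left_cancel₀ (neg_ne_zero.2 Complex.I_ne_zero) h'
      exact_mod_cast this)
    have e : -Complex.I * (x : ℂ) - -Complex.I * y = Complex.I * (y - x) := by ring
    rw [dslope_of_ne _ h, slope_def_module, diffDeriv, if_neg hne, Complex.real_smul, e]
    have := Complex.I_ne_zero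
    push_cast
    field_simp
    ring

/-- The chain rule along E ↦ -iE contributes -i. With the minus sign in front of G̃ in L this
becomes the +i of the Feynman-ordered term. -/
lemma firstVariation_smul_eq_orderedDiff {F : ℂ → ℂ} (hF : IsBoundedC2 F) {H₀ H₂ : Mat N}
    (h₀ : H₀.IsHermitian) (h₂ : H₂.IsHermitian) (c : ℂ) :
    firstVariation h₀ (fun E : ℝ => F (-Complex.I * E)) (c • H₂) =
      -(c • (Complex.I • orderedDiff h₀ h₂ F)) := by
  rw [← neg_smul]
  apply inEigenbases_injective h₀ h₀
  ext k j
  rw [inEigenbases_firstVariation]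
  simp only [inEigenbases_smul, Matrix.of_apply, Matrix.smul_apply, smul_eq_mul,
    inEigenbases_orderedDiff, dslope_comp_neg_I hF]
  ring

end

/-! ### Assembly: asymptotics of the matrix propagator. -/

section

variable {N : ℕ}

open scoped Matrix.Norms.L2Operator

/-- Passes from entrywise estimates to the operator norm, in which products and exponentials can be
handled. -/
lemma isBigO_of_entries {l : Filter ℝ} {A : ℝ → Mat N} {g : ℝ → ℝ}
    (h : ∀ i j, (fun x => A x i j) =O[l] g) : A =O[l] g := by
  have e : A = fun x => ∑ i, ∑ j, A x i j • (Matrix.single i j 1 : Mat N) := by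
    ext1 x
    conv_lhs => rw [Matrix.matrix_eq_sum_single (A x)]
    simp [Matrix.smul_single]
  rw [e]
  refine IsBigO.fun_sum fun i _ => ?_
  refine IsBigO.fun_sum fun j _ => ?_
  simpa using (h i j).smul (isBigO_const_const (Matrix.single i j 1 : Mat N)
    (one_ne_zero (α := ℝ)) l)

lemma isBigO_entry {l : Filter ℝ} {A : ℝ → Mat N} {g : ℝ → ℝ} (h : A =O[l] g) (i j : Fin N) :
    (fun x => A x i j) =O[l] g :=
  ((LinearMap.toContinuousLinearMap (Matrix.entryLinearMap ℂ ℂ i j)).isBigO_comp A l).trans h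

/-- Strict differentiability at the common limit X gives a local Lipschitz bound, so A and B need
not commute. -/
lemma exp_sub_exp_isBigO {l : Filter ℝ} {A B : ℝ → Mat N} {X : Mat N} (hA : Tendsto A l (𝓝 X))
    (hB : Tendsto B l (𝓝 X)) :
    (fun x => NormedSpace.exp (A x) - NormedSpace.exp (B x)) =O[l] fun x => A x - B x :=
  (NormedSpace.exp_analytic (𝕂 := ℂ) X).hasStrictFDerivAt.isBigO_sub.comp_tendsto
    (hA.prodMk_nhds hB)

/-- Expansions of `Q₀`, `Q₁` carry over to `e^{t(-Q₀ + λ² Q₁ Q₀)} (1 - λ² Q₁)`. -/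
lemma exp_mul_sub_exp_mul_isBigO {Q₀ Q₁ : ℝ → Mat N} {P₀ P₁ O : Mat N} (t : ℂ)
    (hQ₀ : (fun lam : ℝ => Q₀ lam - P₀ + ((lam ^ 2 : ℝ) : ℂ) • O) =O[𝓝[≠] 0] fun lam => lam ^ 4)
    (hQ₁ : (fun lam => Q₁ lam - P₁) =O[𝓝[≠] 0] fun lam : ℝ => lam ^ 2) :
    (fun lam : ℝ =>
      NormedSpace.exp (t • (-Q₀ lam + ((lam ^ 2 : ℝ) : ℂ) • (Q₁ lam * Q₀ lam))) *
        (1 - ((lam ^ 2 : ℝ) : ℂ) • Q₁ lam) -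
      NormedSpace.exp (t • (-P₀ + ((lam ^ 2 : ℝ) : ℂ) • (P₁ * P₀ + O))) *
        (1 - ((lam ^ 2 : ℝ) : ℂ) • P₁)) =O[𝓝[≠] 0] fun lam => lam ^ 4 := by
  have hpow : ∀ n : ℕ, n ≠ 0 → Tendsto (fun lam : ℝ => lam ^ n) (𝓝[≠] 0) (𝓝 0) := fun n hn => by
    have : Tendsto (fun lam : ℝ => lam ^ n) (𝓝 0) (𝓝 (0 ^ n)) := (continuous_pow n).tendsto 0
    rw [zero_pow hn] at this
    exact this.mono_left nhdsWithin_le_nhds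
  have hs : Tendsto (fun lam : ℝ => ((lam ^ 2 : ℝ) : ℂ)) (𝓝[≠] 0) (𝓝 0) := by
    have := (Complex.continuous_ofReal.tendsto 0).comp (hpow 2 two_ne_zero)
    simpa [Function.comp_def] using this
  have hsO : (fun lam : ℝ => ((lam ^ 2 : ℝ) : ℂ)) =O[𝓝[≠] 0] fun lam : ℝ => lam ^ 2 :=
    IsBigO.of_bound 1 (Eventually.of_forall fun lam => by
      rw [Complex.norm_real, one_mul])
  have h42 : (fun lam : ℝ => lam ^ 4) =O[𝓝[≠] 0] fun lam : ℝ => lam ^ 2 := by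
    have : (fun lam : ℝ => lam ^ 4) = fun lam => lam ^ 2 * lam ^ 2 := by ext; ring
    rw [this]
    simpa using (isBigO_refl (fun lam : ℝ => lam ^ 2) _).mul ((hpow 2 two_ne_zero).isBigO_one ℝ)
  have hQ₀' : (fun lam => Q₀ lam - P₀) =O[𝓝[≠] 0] fun lam : ℝ => lam ^ 2 := by
    have h1 : (fun lam : ℝ => ((lam ^ 2 : ℝ) : ℂ) • O) =O[𝓝[≠] 0] fun lam : ℝ => lam ^ 2 := by
      simpa using hsO.smul (isBigO_const_const O (one_ne_zero (α := ℝ)) (𝓝[≠] (0 : ℝ)))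
    simpa using (hQ₀.trans h42).sub h1
  have tQ₀ : Tendsto Q₀ (𝓝[≠] 0) (𝓝 P₀) :=
    tendsto_sub_nhds_zero_iff.1 (hQ₀'.trans_tendsto (hpow 2 two_ne_zero))
  have tQ₁ : Tendsto Q₁ (𝓝[≠] 0) (𝓝 P₁) :=
    tendsto_sub_nhds_zero_iff.1 (hQ₁.trans_tendsto (hpow 2 two_ne_zero))
  have hprod : (fun lam => Q₁ lam * Q₀ lam - P₁ * P₀) =O[𝓝[≠] 0] fun lam : ℝ => lam ^ 2 := by
    have h1 : (fun lam => (Q₁ lam - P₁) * Q₀ lam) =O[𝓝[≠] 0] fun lam : ℝ => lam ^ 2 := by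
      simpa using hQ₁.mul (tQ₀.isBigO_one ℝ)
    have h2 : (fun lam => P₁ * (Q₀ lam - P₀)) =O[𝓝[≠] 0] fun lam : ℝ => lam ^ 2 := by
      simpa using (isBigO_const_const P₁ (one_ne_zero (α := ℝ)) (𝓝[≠] (0 : ℝ))).mul hQ₀'
    refine (h1.add h2).congr_left fun lam => ?_
    noncomm_ring
  have hmul4 : ∀ {X : ℝ → Mat N}, (X =O[𝓝[≠] 0] fun lam : ℝ => lam ^ 2) →
      (fun lam : ℝ => ((lam ^ 2 : ℝ) : ℂ) • X lam) =O[𝓝[≠] 0] fun lam : ℝ => lam ^ 4 := by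
    intro X hX
    refine (hsO.smul hX).congr_right fun lam => ?_
    rw [smul_eq_mul]; ring
  set L' : ℝ → Mat N := fun lam =>
    t • (-Q₀ lam + ((lam ^ 2 : ℝ) : ℂ) • (Q₁ lam * Q₀ lam)) with hL'
  set L : ℝ → Mat N := fun lam => t • (-P₀ + ((lam ^ 2 : ℝ) : ℂ) • (P₁ * P₀ + O)) with hL
  -- Up to the factor t, L' - L is λ²(Q₁Q₀ - P₁P₀) minus the expression in `hQ₀`; the prefactor λ²
  -- is why Q₁ is needed only to order λ².
  have hLL : (fun lam => L' lam - L lam) =O[𝓝[≠] 0] fun lam : ℝ => lam ^ 4 := by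
    have h1 := ((hmul4 hprod).sub hQ₀).const_smul_left t
    refine h1.congr_left fun lam => ?_
    simp only [hL', hL, Pi.smul_apply]
    module
  have tL' : Tendsto L' (𝓝[≠] 0) (𝓝 (t • (-P₀ + (0 : ℂ) • (P₁ * P₀)))) :=
    (tQ₀.neg.add (hs.smul (tQ₁.mul tQ₀))).const_smul t
  have tL : Tendsto L (𝓝[≠] 0) (𝓝 (t • (-P₀ + (0 : ℂ) • (P₁ * P₀)))) := by
    rw [zero_smul, ← zero_smul ℂ (P₁ * P₀ + O)]
    exact (tendsto_const_nhds.add (hs.smul tendsto_const_nhds)).const_smul t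
  have hexp := (exp_sub_exp_isBigO tL' tL).trans hLL
  have hr : (fun lam : ℝ => 1 - ((lam ^ 2 : ℝ) : ℂ) • Q₁ lam) =O[𝓝[≠] 0] fun _ => (1 : ℝ) :=
    (tendsto_const_nhds.sub (hs.smul tQ₁)).isBigO_one ℝ
  have hrr := hmul4 hQ₁
  have hexpb : (fun lam => NormedSpace.exp (L lam)) =O[𝓝[≠] 0] fun _ => (1 : ℝ) :=
    (((NormedSpace.exp_analytic (𝕂 := ℂ) _).continuousAt.tendsto).comp tL).isBigO_one ℝ
  -- The difference of products is split as (e^{L'} - e^L) r' + e^L (r' - r).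
  have s1 := hexp.mul hr
  have s2 := hexpb.mul hrr
  simp only [mul_one, one_mul] at s1 s2
  refine (s1.sub s2).congr_left fun lam => ?_
  change _ = NormedSpace.exp (L' lam) * (1 - ((lam ^ 2 : ℝ) : ℂ) • Q₁ lam) -
    NormedSpace.exp (L lam) * (1 - ((lam ^ 2 : ℝ) : ℂ) • P₁)
  simp only [sub_mul, mul_sub, smul_sub]
  abel

lemma isHermitian_add_sq_smul {H₀ H₂ : Mat N} (h₀ : H₀.IsHermitian) (h₂ : H₂.IsHermitian)
    (lam : ℝ) : (H₀ + ((lam ^ 2 : ℝ) : ℂ) • H₂).IsHermitian := by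
  rw [Matrix.IsHermitian, Matrix.conjTranspose_add, Matrix.conjTranspose_smul, h₀.eq, h₂.eq]
  simp

/-- Weak coupling asymptotics of the propagator in terms of functions of the full Hamiltonian. -/
lemma propagator_sub_matFun_isBigO {ν : Measure ℝ} [IsFiniteMeasure ν] {F F₁ F₂ : ℂ → ℂ} {B : ℝ}
    (hF : HasC2Bound F F₁ F₂ B) (hν : IsLaplaceTransform (spectralCorrelation ν) F)
    {H : ℝ → Mat N} (hH : ∀ lam, (H lam).IsHermitian) {V : ℝ → ℝ → Mat N}
    (hV : ∀ lam : ℝ, lam ≠ 0 →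
      IsPropagator (fun t => ((lam ^ 2 : ℝ) : ℂ) * spectralCorrelation ν t) (H lam) (V lam))
    {t : ℝ} (ht : 0 < t) :
    (fun lam : ℝ => V lam ((lam ^ 2)⁻¹ * t) - matFun (hH lam) (fun E =>
      (1 - ((lam ^ 2 : ℝ) : ℂ) * F₁ (-Complex.I * E)) * Complex.exp (t *
        (-F (-Complex.I * E) * (1 - ((lam ^ 2 : ℝ) : ℂ) * F₁ (-Complex.I * E))))))
      =O[𝓝[≠] 0] fun lam => lam ^ 4 := by
  obtain ⟨C, hC⟩ := scalar_asymptotics hF hν ht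
  refine isBigO_of_entries fun i j => IsBigO.of_bound (N ^ 2 * |C|) ?_
  have hsmall : ∀ᶠ lam : ℝ in 𝓝[≠] 0, lam ^ 2 * (B + 1) < 1 / 2 := by
    have : Tendsto (fun lam : ℝ => lam ^ 2 * (B + 1)) (𝓝 0) (𝓝 (0 ^ 2 * (B + 1))) :=
      (by fun_prop : Continuous fun lam : ℝ => lam ^ 2 * (B + 1)).tendsto 0
    exact (this.mono_left nhdsWithin_le_nhds).eventually_lt_const (by norm_num)
  filter_upwards [hsmall, self_mem_nhdsWithin] with lam hl hne
  have hpos : 0 < lam ^ 2 := by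
    have : lam ≠ 0 := hne
    positivity
  have h4 : ‖lam ^ 4‖ = (lam ^ 2) ^ 2 := by
    rw [Real.norm_of_nonneg (by positivity)]; ring
  rw [h4, mul_assoc]
  refine norm_le_of_inEigenbases (hH lam) (hH lam) (fun α β => ?_) i j
  obtain ⟨hxc, hx⟩ := (hV lam hne).inEigenbases_volterra (hH lam) α β
  -- Here the energy is an eigenvalue of H lam and moves with lam; a constant C uniform in E is
  -- indispensable.
  have h := hC (lam ^ 2) hpos hl.le _ _ hxc hx
  have hτ : 0 ≤ (lam ^ 2)⁻¹ * t := by positivity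
  simp only [max_self, max_eq_left hτ] at h
  rw [(hV lam hne).1, inEigenbases_self_one, Matrix.one_apply] at h
  rw [inEigenbases_sub, inEigenbases_matFun, Matrix.sub_apply, Matrix.diagonal_apply]
  have hb : ‖(if α = β then 1 else 0 : ℂ)‖ ≤ 1 := by split_ifs <;> simp
  refine le_trans (le_of_eq ?_) (h.trans ?_)
  · congr 2
    split_ifs <;> simp
  · calc C * (lam ^ 2) ^ 2 * _ ≤ |C| * (lam ^ 2) ^ 2 * 1 := by
          gcongr
          exact le_abs_self C
      _ = _ := mul_one _

/-- Weak coupling asymptotics of the propagator for a bath with a given spectral measure. -/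
theorem propagator_asymptotics {ν : Measure ℝ} [IsFiniteMeasure ν] {Gt : ℂ → ℂ}
    (hGt : IsLaplaceTransform (spectralCorrelation ν) Gt) (hC2 : IsBoundedC2 Gt)
    {H₀ H₂ : Mat N} (h₀ : H₀.IsHermitian) (h₂ : H₂.IsHermitian) {V : ℝ → ℝ → Mat N}
    (hV : ∀ lam : ℝ, lam ≠ 0 →
      IsPropagator (fun t => ((lam ^ 2 : ℝ) : ℂ) * spectralCorrelation ν t)
        (H₀ + ((lam ^ 2 : ℝ) : ℂ) • H₂) (V lam))
    {t : ℝ} (ht : 0 < t) (i j : Fin N) :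
    (fun lam : ℝ => (V lam ((lam ^ 2)⁻¹ * t) -
      NormedSpace.exp ((t : ℂ) • LMat h₀ h₂ Gt lam) * rMat h₀ Gt lam) i j)
      =O[𝓝[≠] (0 : ℝ)] (fun lam : ℝ => lam ^ 4) := by
  obtain ⟨B, hB⟩ := hC2.exists_hasC2Bound fun p hp => hGt.norm_le hp
  have hH := fun lam : ℝ => isHermitian_add_sq_smul h₀ h₂ lam
  have hVO := propagator_sub_matFun_isBigO hB hGt hH hV ht
  set f₀ : ℝ → ℂ := fun E => Gt (-Complex.I * E) with hf₀
  set f₁ : ℝ → ℂ := fun E => hpDeriv Gt (-Complex.I * E) with hf₁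
  have hlip : ∀ x y, ‖f₁ x - f₁ y‖ ≤ B * |x - y| := by
    intro x y
    have hmem : ∀ E : ℝ, -Complex.I * (E : ℂ) ∈ closedHalfPlane := fun E => by
      simp [closedHalfPlane]
    have := hB.lipschitz (hmem y) (hmem x)
    rwa [← mul_sub, norm_mul, norm_neg, Complex.norm_I, one_mul, ← Complex.ofReal_sub,
      Complex.norm_real, Real.norm_eq_abs] at this
  have hlip' : ∀ x y, ‖-Complex.I * f₁ x - -Complex.I * f₁ y‖ ≤ B * |x - y| := by
    intro x y
    rw [← mul_sub, norm_mul, norm_neg, Complex.norm_I, one_mul]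
    exact hlip x y
  obtain ⟨M, hM⟩ : ∃ M : ℝ, ∀ i j, ‖H₂ i j‖ ≤ M := by
    refine ⟨∑ i, ∑ j, ‖H₂ i j‖, fun i j => ?_⟩
    exact (Finset.single_le_sum (f := fun j => ‖H₂ i j‖) (fun _ _ => norm_nonneg _)
      (Finset.mem_univ j)).trans (Finset.single_le_sum (f := fun i => ∑ j, ‖H₂ i j‖)
        (fun _ _ => Finset.sum_nonneg fun _ _ => norm_nonneg _) (Finset.mem_univ i))
  have hdiff : ∀ lam : ℝ, H₀ + ((lam ^ 2 : ℝ) : ℂ) • H₂ - H₀ = ((lam ^ 2 : ℝ) : ℂ) • H₂ :=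
    fun lam => add_sub_cancel_left _ _
  have hM' : ∀ (lam : ℝ) (i j), ‖(H₀ + ((lam ^ 2 : ℝ) : ℂ) • H₂ - H₀) i j‖ ≤ lam ^ 2 * M := by
    intro lam i j
    rw [hdiff, Matrix.smul_apply, norm_smul, Complex.norm_real,
      Real.norm_of_nonneg (sq_nonneg lam)]
    gcongr
    exact hM i j
  have hQ₀ : (fun lam : ℝ => matFun (hH lam) f₀ - funNegI h₀ Gt +
      ((lam ^ 2 : ℝ) : ℂ) • (Complex.I • orderedDiff h₀ h₂ Gt)) =O[𝓝[≠] 0]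
      fun lam => lam ^ 4 := by
    refine isBigO_of_entries fun i j => IsBigO.of_bound
      (N ^ 2 * (N * (B * (N ^ 2 * M) * (N ^ 2 * M)))) (Eventually.of_forall fun lam => ?_)
    have h := norm_matFun_sub_firstVariation_le (hH lam) h₀ hC2.hasDerivAt_comp_neg_I hlip'
      (hM' lam) i j
    rw [hdiff, firstVariation_smul_eq_orderedDiff hC2 h₀ h₂, sub_neg_eq_add] at h
    refine h.trans (le_of_eq ?_)
    rw [Real.norm_of_nonneg (by positivity)]
    ring
  have hQ₁ : (fun lam : ℝ => matFun (hH lam) f₁ - funNegI h₀ (hpDeriv Gt)) =O[𝓝[≠] 0]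
      fun lam => lam ^ 2 := by
    refine isBigO_of_entries fun i j => IsBigO.of_bound
      (N ^ 2 * (B * (N ^ 2 * M))) (Eventually.of_forall fun lam => ?_)
    refine (norm_matFun_sub_le (hH lam) h₀ hlip (hM' lam) i j).trans (le_of_eq ?_)
    rw [Real.norm_of_nonneg (by positivity)]
    ring
  have hmain := hVO.add (exp_mul_sub_exp_mul_isBigO (t : ℂ) hQ₀ hQ₁)
  refine (isBigO_entry hmain i j).congr' ?_ EventuallyEq.rfl
  refine Eventually.of_forall fun lam => ?_
  -- An exact identity: -f₀(1 - λ²f₁) = -f₀ + λ²f₁f₀, and functions of one Hermitian matrix commute,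
  -- so no error arises here.
  have hfun : matFun (hH lam) (fun E => (1 - ((lam ^ 2 : ℝ) : ℂ) * f₁ E) *
      Complex.exp (t * (-f₀ E * (1 - ((lam ^ 2 : ℝ) : ℂ) * f₁ E)))) =
      NormedSpace.exp ((t : ℂ) • (-matFun (hH lam) f₀ + ((lam ^ 2 : ℝ) : ℂ) •
        (matFun (hH lam) f₁ * matFun (hH lam) f₀))) *
        (1 - ((lam ^ 2 : ℝ) : ℂ) • matFun (hH lam) f₁) := by
    have e : (fun E : ℝ => (1 - ((lam ^ 2 : ℝ) : ℂ) * f₁ E) *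
        Complex.exp (t * (-f₀ E * (1 - ((lam ^ 2 : ℝ) : ℂ) * f₁ E)))) =
        fun E => Complex.exp (t * (((lam ^ 2 : ℝ) : ℂ) * (f₁ E * f₀ E) - f₀ E)) *
          (1 - ((lam ^ 2 : ℝ) : ℂ) * f₁ E) := by
      ext E; rw [mul_comm]; congr 2; ring
    rw [e, matFun_mul, matFun_exp, matFun_const_mul, matFun_sub, matFun_const_mul, matFun_mul,
      matFun_sub, matFun_const_mul, matFun_one, neg_add_eq_sub]
  simp only [LMat, rMat, hf₀, hf₁] at hfun ⊢
  rw [hfun, sub_add_sub_cancel]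

end

end RWAModel

theorem theorem2 {N : ℕ} (g : ℝ → ℂ) (ω : ℝ → ℝ) (hG : RWAModel.BathAdmissible g ω)
    (Gt : ℂ → ℂ) (hGt : RWAModel.IsLaplaceTransform (RWAModel.bathCorrelation g ω) Gt)
    (hC2 : RWAModel.IsBoundedC2 Gt)
    (H₀ H₂ : Matrix (Fin N) (Fin N) ℂ) (h₀ : H₀.IsHermitian) (h₂ : H₂.IsHermitian)
    (V W : ℝ → ℝ → Matrix (Fin N) (Fin N) ℂ)
    (hV : ∀ lam : ℝ, lam ≠ 0 →
      RWAModel.IsPropagator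
        (fun t => ((lam ^ 2 : ℝ) : ℂ) * RWAModel.bathCorrelation g ω t)
        (H₀ + ((lam ^ 2 : ℝ) : ℂ) • H₂) (V lam))
    (hW : ∀ lam : ℝ, lam ≠ 0 → ∀ t : ℝ, W lam t = V lam ((lam ^ 2)⁻¹ * t))
    (t : ℝ) (ht : 0 < t) (i j : Fin N) :
    (fun lam : ℝ =>
      (W lam t - NormedSpace.exp ((t : ℂ) • RWAModel.LMat h₀ h₂ Gt lam) *
        RWAModel.rMat h₀ Gt lam) i j)
      =O[𝓝[≠] (0 : ℝ)] (fun lam : ℝ => lam ^ 4) := by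
  obtain ⟨ν, hν, hGν⟩ := hG.exists_spectralCorrelation
  -- From here on the bath enters only through its spectral measure ν.
  have hGν' : RWAModel.bathCorrelation g ω = RWAModel.spectralCorrelation ν := funext hGν
  rw [hGν'] at hGt hV
  refine (RWAModel.propagator_asymptotics hGt hC2 h₀ h₂ hV ht i j).congr' ?_ EventuallyEq.rfl
  filter_upwards [self_mem_nhdsWithin] with lam hne
  rw [hW lam hne]
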